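/- Let $S^2\subset\mathbb{R}^3$ be the unit sphere with its area measure $\operatorname{vol}$ (so $\operatorname{vol}(S^2)=4\pi$). For $m\ge 0$ let $\phi_1,\dots,\phi_{2m+1}$ be an orthonormal basis in $L^2(S^2)$ of the real spherical harmonics of degree $m$, and let $\phi=\sum_j c_j\phi_j$ with independent Gaussian coefficients $c_j$ of mean $0$ and variance $1/(2m+1)$. For $r>0$ and $z\in S^2$ let $B_r(z)$ be the geodesic ball of radius $r$ centred at $z$, write $\operatorname{vol}(B_r)=\operatorname{vol}(B_r(z))$ (independent of $z$), and put $$X_z=\frac{1}{\operatorname{vol}(B_r)}\int_{B_r(z)}\phi^2 .$$ Then $X_z$ is square-integrable and, for all $z\in S^2$, $r>0$ and $m\ge 0$, $$\operatorname{var}[X_z]=\frac{2}{\operatorname{vol}(S^2)^2}\int_{B_r(z)}\int_{B_r(z)}P_m(x\cdot x')^2\,\frac{dx}{\operatorname{vol}(B_r)}\,\frac{dx'}{\operatorname{vol}(B_r)},$$ where $P_m$ is the Legendre polynomial of degree $m$ normalized so that $P_m(1)=1$. Moreover, $\operatorname{var}[X_z]\asymp 1/(rm)$ in the following sense: there are absolute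 constants $C_1,C_2,K>0$ such that for all $z\in S^2$, $m\ge 1$ and $0<r\le\pi$, $$\operatorname{var}[X_z]\le\frac{C_2}{rm},\qquad\text{and if } rm\ge K,\text{ then}\qquad \operatorname{var}[X_z]\ge\frac{C_1}{rm}.$$ -/

import Mathlib

open MeasureTheory ProbabilityTheory
open scoped NNReal

noncomputable section

/-- The unit sphere `S²` in Euclidean three-space. -/
abbrev S2 : Type := Metric.sphere (0 : EuclideanSpace ℝ (Fin 3)) 1

/-- The surface area measure on `S²`, of total mass `4π`. -/
def area : Measure S2 := (volume : Measure (EuclideanSpace ℝ (Fin 3))).toSphere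

/-- The open geodesic ball (spherical cap) of radius `r` centred at `z`; the geodesic distance
of two points of the unit sphere is the angle between them. -/
def geoBall (z : S2) (r : ℝ) : Set S2 :=
  {x | InnerProductGeometry.angle (z : EuclideanSpace ℝ (Fin 3)) x < r}

/-- The Laplace operator on real polynomials in three variables. -/
def polyLaplacian : MvPolynomial (Fin 3) ℝ →ₗ[ℝ] MvPolynomial (Fin 3) ℝ :=
  ∑ i : Fin 3, (MvPolynomial.pderiv i).toLinearMap ∘ₗ (MvPolynomial.pderiv i).toLinearMap

/-- Restriction of a polynomial in three variables to a function on `S²`. -/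
def restrictToSphere : MvPolynomial (Fin 3) ℝ →ₗ[ℝ] (S2 → ℝ) where
  toFun p x := MvPolynomial.eval (fun i => (x : EuclideanSpace ℝ (Fin 3)) i) p
  map_add' p q := by ext x; simp
  map_smul' a p := by ext x; simp [MvPolynomial.smul_eval]

/-- The real spherical harmonics of degree `m` on `S²`: the restrictions to the sphere of the
harmonic homogeneous polynomials of degree `m` in three variables. -/
def sphericalHarmonics (m : ℕ) : Submodule ℝ (S2 → ℝ) :=
  (MvPolynomial.homogeneousSubmodule (Fin 3) ℝ m ⊓ LinearMap.ker polyLaplacian).map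
    restrictToSphere

/-- The functions `φ j` form an orthonormal basis, for the inner product of `L²(S²)`, of the
space of spherical harmonics of degree `m`. -/
structure IsHarmonicONB (m : ℕ) (φ : Fin (2 * m + 1) → S2 → ℝ) : Prop where
  orthonormal : ∀ i j, ∫ x, φ i x * φ j x ∂area = if i = j then 1 else 0
  span_eq : Submodule.span ℝ (Set.range φ) = sphericalHarmonics m

/-- The coefficients `c j` are independent Gaussian random variables, each of mean `0` and
variance `1 / (2m + 1)`. -/
structure IsGaussianCoeff {Ω : Type*} [MeasurableSpace Ω] (P : Measure Ω) (m : ℕ)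
    (c : Fin (2 * m + 1) → Ω → ℝ) : Prop where
  hasLaw : ∀ j, HasLaw (c j) (gaussianReal 0 (1 / (2 * (m : ℝ≥0) + 1))) P
  indep : iIndepFun c P

/-- The random spherical harmonic `ϕ = ∑ c_j φ_j`. -/
def randomHarmonic {Ω : Type*} {m : ℕ} (φ : Fin (2 * m + 1) → S2 → ℝ)
    (c : Fin (2 * m + 1) → Ω → ℝ) (ω : Ω) (x : S2) : ℝ :=
  ∑ j, c j ω * φ j x

/-- The random variable `X_z = vol(B_r)⁻¹ ∫_{B_r(z)} ϕ²`. -/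
def capMean {Ω : Type*} {m : ℕ} (φ : Fin (2 * m + 1) → S2 → ℝ)
    (c : Fin (2 * m + 1) → Ω → ℝ) (r : ℝ) (z : S2) (ω : Ω) : ℝ :=
  (area.real (geoBall z r))⁻¹ * ∫ x in geoBall z r, randomHarmonic φ c ω x ^ 2 ∂area

/-- The Legendre polynomial of degree `m`, by Rodrigues' formula. -/
def legendre (m : ℕ) : Polynomial ℝ :=
  Polynomial.C (1 / (2 ^ m * (m.factorial : ℝ))) *
    (Polynomial.derivative^[m] ((Polynomial.X ^ 2 - 1) ^ m))

/-- The normalization `P_m(1) = 1`. -/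
theorem legendre_eval_one (m : ℕ) : (legendre m).eval 1 = 1 := by
  have h2 : (Polynomial.taylor (1 : ℝ)) ((Polynomial.X ^ 2 - 1) ^ m)
      = Polynomial.X ^ m * (Polynomial.X + 2) ^ m := by
    rw [← mul_pow, Polynomial.taylor_pow]
    congr 1
    simp [Polynomial.taylor_apply]
    ring
  have h3 : ((Polynomial.taylor (1 : ℝ)) ((Polynomial.X ^ 2 - 1) ^ m)).coeff m = 2 ^ m := by
    rw [h2, Polynomial.coeff_X_pow_mul', if_pos le_rfl, Nat.sub_self,
      Polynomial.coeff_zero_eq_eval_zero]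
    simp
  rw [Polynomial.taylor_coeff] at h3
  have h4 := congrArg (Polynomial.eval (1 : ℝ))
    (congrFun (Polynomial.factorial_smul_hasseDeriv (R := ℝ) m) ((Polynomial.X ^ 2 - 1) ^ m))
  have hm : (m.factorial : ℝ) ≠ 0 := by positivity
  change Polynomial.eval 1 (m.factorial • Polynomial.hasseDeriv m ((Polynomial.X ^ 2 - 1) ^ m))
    = _ at h4
  rw [Polynomial.eval_smul, h3, nsmul_eq_mul] at h4
  rw [legendre, Polynomial.eval_mul, Polynomial.eval_C, ← h4]
  field_simp

end

/-!
The variance of `X_z` is that of a quadratic form `∑ a_jk c_j c_k` in independent Gaussian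
variables, which is twice the squared Hilbert–Schmidt norm of `a` times the square of the common
variance (`variance_quadratic_of_gaussian`, from Wick's formula). Here `a_jk` is the mean of
`φ_j φ_k` over the cap, so that the norm is the double integral over the cap of the square of the
reproducing kernel `∑ φ_j(x) φ_j(x')`, and the addition theorem (`IsHarmonicONB.sphereKernel_eq`)
identifies this kernel with a multiple of `P_m (x · x')`.

For the addition theorem, isometries act on the spherical harmonics by orthogonal matrices, so the
kernel depends on `x · x'` only. With one argument fixed it is the restriction of a harmonic
homogeneous polynomial with axial symmetry, hence a polynomial in `x · x'`, and this polynomial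
solves Legendre's equation (`exists_isLegendreSolution`). Such a solution is determined by its value
at `1` (`IsLegendreSolution.eq_zero`); the constant comes from the trace of the kernel.

For the size of the variance, Archimedes' theorem (`lintegral_inner_area`) turns the integral of
`P_m (x · x')²` over a cap of radius `R` about `x` into that of `sin θ P_m (cos θ)²` over
`0 < θ < R`, up to the factor `2 π`. With `μ² = m (m + 1)`, the function `u = √(sin θ) P_m (cos θ)`
satisfies `u'' + q u = 0` with `q` positive, decreasing on `(0, π / 2)` and comparable to `μ²` for
`θ ≥ 1 / (2 μ)`. There `u'² + q u²` decreases, while `u² + u'² / q` increases (Sonin), so the energy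
is comparable to its value at `1 / (2 μ)`, which is comparable to `μ`. This gives `u² = O(1 / μ)`
and, since `u'²` and `q u²` have the same mean up to boundary terms, also that the integral of `u²`
over `(0, R)` is at least a constant times `R / μ` once `μ R` is large
(`IsPolarLegendre.integral_le`, `IsPolarLegendre.le_integral`). Comparing caps of radius `r` with
caps of radius `2 r` and `r / 2` finishes the proof.
-/

/-! ### Legendre's differential equation -/

section LegendreODE

open Polynomial

/-- The relation `(X² - 1) w' = 2 m X w` for `w = (X² - 1)^m`, differentiated `n + 1` times; the
case `n = m` is Legendre's equation for the polynomial of Rodrigues' formula. -/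
theorem iterate_derivative_ode {R : Type*} [CommRing R] (m n : ℕ) :
    ((X : R[X]) ^ 2 - 1) * derivative^[n + 2] ((X ^ 2 - 1) ^ m)
      + (2 * ((n : R[X]) + 1) - 2 * (m : R[X])) * X * derivative^[n + 1] ((X ^ 2 - 1) ^ m)
      + (((n : R[X]) + 1) * (n : R[X]) - 2 * (m : R[X]) * ((n : R[X]) + 1))
        * derivative^[n] ((X ^ 2 - 1) ^ m) = 0 := by
  induction n with
  | zero =>
    have h : ((X : R[X]) ^ 2 - 1) * derivative ((X ^ 2 - 1) ^ m)
        = 2 * (m : R[X]) * X * (X ^ 2 - 1) ^ m := by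
      rcases m with _ | m
      · simp
      · rw [derivative_pow]
        simp
        ring
    have h' := congrArg derivative h
    simp [derivative_mul] at h'
    simp only [Function.iterate_succ', Function.comp, Function.iterate_zero, id]
    push_cast
    linear_combination h'
  | succ n ih =>
    have h := congrArg derivative ih
    simp only [derivative_add, derivative_mul, derivative_sub, derivative_pow, derivative_X,
      derivative_one, derivative_natCast, derivative_ofNat, derivative_zero,
      ← Function.iterate_succ_apply' derivative] at h
    simp only [mul_zero, zero_mul, add_zero, zero_add, sub_zero, Nat.cast_ofNat, map_ofNat,
      Nat.add_one_sub_one, pow_one, mul_one] at h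
    rw [show n + 1 + 2 = n + 2 + 1 from rfl]
    push_cast
    linear_combination h

/-- `A` solves Legendre's equation of degree `m`. -/
def IsLegendreSolution (m : ℕ) (A : ℝ[X]) : Prop :=
  (1 - X ^ 2) * derivative (derivative A) - 2 * X * derivative A
    + (m : ℝ[X]) * ((m : ℝ[X]) + 1) * A = 0

theorem isLegendreSolution_legendre (m : ℕ) : IsLegendreSolution m (legendre m) := by
  have h := iterate_derivative_ode (R := ℝ) m m
  simp only [Function.iterate_succ_apply'] at h
  simp only [IsLegendreSolution, legendre, derivative_C_mul]
  linear_combination -C (1 / (2 ^ m * (m.factorial : ℝ))) * h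

/-- A solution of Legendre's equation is determined by its value at the singular point `1`: the
equation, differentiated `n` times there, expresses the derivative of order `n + 1` through that
of order `n`. -/
theorem IsLegendreSolution.eq_zero {m : ℕ} {A : ℝ[X]} (hA : IsLegendreSolution m A)
    (h1 : A.eval 1 = 0) : A = 0 := by
  have key : ∀ n : ℕ, (1 - X ^ 2) * derivative^[n + 2] A
      - 2 * ((n : ℝ[X]) + 1) * X * derivative^[n + 1] A
      + ((m : ℝ[X]) * ((m : ℝ[X]) + 1) - (n : ℝ[X]) * ((n : ℝ[X]) + 1))
        * derivative^[n] A = 0 := by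
    intro n
    induction n with
    | zero =>
      simp only [IsLegendreSolution] at hA
      simp only [Function.iterate_succ', Function.comp, Function.iterate_zero, id]
      push_cast
      linear_combination hA
    | succ n ih =>
      have h := congrArg derivative ih
      simp only [derivative_add, derivative_mul, derivative_sub, derivative_pow, derivative_X,
        derivative_one, derivative_natCast, derivative_ofNat, derivative_zero,
        ← Function.iterate_succ_apply' derivative] at h
      simp only [mul_zero, zero_mul, add_zero, zero_add, sub_zero, Nat.cast_ofNat, map_ofNat,
        Nat.add_one_sub_one, pow_one, mul_one, zero_sub] at h
      rw [show n + 1 + 2 = n + 2 + 1 from rfl]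
      push_cast
      linear_combination h
  have hz : ∀ n : ℕ, (derivative^[n] A).eval 1 = 0 := by
    intro n
    induction n with
    | zero => simpa using h1
    | succ n ih =>
      have h := congrArg (eval 1) (key n)
      simp [ih] at h
      rcases h with h | h
      · exact absurd h (by positivity)
      · simpa using h
  refine (taylor_injective (1 : ℝ)) (Polynomial.ext fun n => ?_)
  have h4 := congrArg (Polynomial.eval (1 : ℝ))
    (congrFun (Polynomial.factorial_smul_hasseDeriv (R := ℝ) n) A)
  change Polynomial.eval 1 (n.factorial • Polynomial.hasseDeriv n A) = _ at h4
  rw [hz n, eval_smul, smul_eq_zero] at h4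
  rw [taylor_coeff]
  simpa [Nat.factorial_ne_zero] using h4

theorem IsLegendreSolution.eq_C_mul_legendre {m : ℕ} {A : ℝ[X]} (hA : IsLegendreSolution m A) :
    A = C (A.eval 1) * legendre m := by
  refine sub_eq_zero.1 (IsLegendreSolution.eq_zero (m := m) ?_ ?_)
  · have hP := isLegendreSolution_legendre m
    simp only [IsLegendreSolution] at hA hP ⊢
    simp only [derivative_sub, derivative_C_mul]
    linear_combination hA - C (A.eval 1) * hP
  · simp [legendre_eval_one]

end LegendreODE

/-! ### The size of Legendre polynomials -/

section LegendreSize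

open Real Polynomial

/-- On `[0, 1]` the quantity `λ P² + (1 - t²) P'²` with `λ = m (m + 1)` has derivative `2 t P'²`,
so it is at most its value `λ` at `t = 1`. -/
theorem legendre_sonin (m : ℕ) {t : ℝ} (h0 : 0 ≤ t) (h1 : t ≤ 1) :
    (m : ℝ) * (m + 1) * (legendre m).eval t ^ 2
      + (1 - t ^ 2) * (derivative (legendre m)).eval t ^ 2 ≤ m * (m + 1) := by
  set Q : ℝ[X] := C ((m : ℝ) * (m + 1)) * legendre m ^ 2
    + (1 - X ^ 2) * derivative (legendre m) ^ 2 with hQ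
  have hQ' : derivative Q = 2 * X * derivative (legendre m) ^ 2 := by
    have h := isLegendreSolution_legendre m
    simp only [IsLegendreSolution] at h
    simp only [hQ, derivative_add, derivative_mul, derivative_pow, derivative_sub, derivative_C,
      derivative_one, derivative_X]
    simp only [C_mul, C_add, C_1, map_natCast, map_ofNat, Nat.cast_ofNat, Nat.add_one_sub_one,
      pow_one]
    linear_combination 2 * derivative (legendre m) * h
  have hmono : MonotoneOn (fun t => Q.eval t) (Set.Icc 0 1) := by
    refine monotoneOn_of_deriv_nonneg (convex_Icc 0 1) Q.continuous.continuousOn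
      Q.differentiable.differentiableOn fun x hx => ?_
    rw [interior_Icc] at hx
    rw [Polynomial.deriv, hQ']
    have := hx.1.le
    simp only [eval_mul, eval_pow, eval_X, eval_ofNat]
    positivity
  have := hmono ⟨h0, h1⟩ ⟨zero_le_one, le_rfl⟩ h1
  simpa [hQ, legendre_eval_one] using this

/-- `f` and `g` are a solution of Legendre's equation in the polar angle `θ` and its derivative,
with the bounds that hold for `P_m (cos θ)` on `[0, π / 2]`; `μ ^ 2 = m (m + 1)`. -/
structure IsPolarLegendre (μ : ℝ) (f g : ℝ → ℝ) : Prop where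
  one_le : 1 ≤ μ
  hasDerivAt_fst : ∀ θ, HasDerivAt f (g θ) θ
  hasDerivAt_snd : ∀ θ, sin θ ≠ 0 → HasDerivAt g (-(cos θ / sin θ) * g θ - μ ^ 2 * f θ) θ
  sq_fst_le : ∀ θ ∈ Set.Icc 0 (π / 2), f θ ^ 2 ≤ 1
  sq_snd_le : ∀ θ ∈ Set.Icc 0 (π / 2), g θ ^ 2 ≤ μ ^ 2
  fst_zero : f 0 = 1

theorem isPolarLegendre_legendre {m : ℕ} (hm : 1 ≤ m) :
    IsPolarLegendre (√((m : ℝ) * (m + 1))) (fun θ => (legendre m).eval (cos θ))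
      (fun θ => -sin θ * (derivative (legendre m)).eval (cos θ)) := by
  have hm' : (1 : ℝ) ≤ m := by exact_mod_cast hm
  have hsq : √((m : ℝ) * (m + 1)) ^ 2 = m * (m + 1) := sq_sqrt (by positivity)
  have hd : ∀ (A : ℝ[X]) θ, HasDerivAt (fun θ => A.eval (cos θ))
      ((derivative A).eval (cos θ) * -sin θ) θ :=
    fun A θ => (A.hasDerivAt (cos θ)).comp θ (hasDerivAt_cos θ)
  have hson : ∀ θ ∈ Set.Icc 0 (π / 2), _ := fun θ hθ =>
    legendre_sonin m (t := cos θ) (cos_nonneg_of_mem_Icc ⟨by linarith [hθ.1, pi_pos], hθ.2⟩)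
      (cos_le_one θ)
  refine ⟨?_, ?_, ?_, ?_, ?_, ?_⟩
  · rw [one_le_sqrt]
    nlinarith
  · intro θ
    exact (hd _ θ).congr_deriv (by ring)
  · intro θ hs
    refine ((hasDerivAt_sin θ).neg.mul (hd _ θ)).congr_deriv ?_
    have h := congrArg (eval (cos θ)) (isLegendreSolution_legendre m)
    simp only [eval_add, eval_sub, eval_mul, eval_pow, eval_X, eval_one, eval_ofNat,
      eval_natCast, eval_zero, ← sin_sq] at h
    rw [hsq, Pi.neg_apply]
    field_simp
    linear_combination h
  · intro θ hθ
    have h := hson θ hθ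
    have : 0 ≤ (1 - cos θ ^ 2) * (derivative (legendre m)).eval (cos θ) ^ 2 := by
      rw [← sin_sq]
      positivity
    have h2 : 0 < (m : ℝ) * (m + 1) := by positivity
    by_contra! hc
    nlinarith
  · intro θ hθ
    have h := hson θ hθ
    rw [hsq, mul_pow, neg_sq, sin_sq]
    have : 0 ≤ (m : ℝ) * (m + 1) * (legendre m).eval (cos θ) ^ 2 := by positivity
    linarith
  · simp [legendre_eval_one]

namespace IsPolarLegendre

variable {μ : ℝ} {f g : ℝ → ℝ}

/-- The energy `u'² + q u²` of the solution `u = √(sin θ) f` of the normal form `u'' + q u = 0` of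
Legendre's equation, where `q = μ ^ 2 + 1 / 4 + 1 / (4 sin² θ)`. -/
noncomputable def energy (μ : ℝ) (f g : ℝ → ℝ) (θ : ℝ) : ℝ :=
  sin θ * g θ ^ 2 + μ ^ 2 * sin θ * f θ ^ 2 + cos θ * f θ * g θ + f θ ^ 2 / (2 * sin θ)

/-- The coefficient `q` of the normal form of Legendre's equation. -/
noncomputable def potential (μ : ℝ) (θ : ℝ) : ℝ := μ ^ 2 + 1 / 4 + 1 / (4 * sin θ ^ 2)

theorem energy_eq {θ : ℝ} (hs : sin θ ≠ 0) : energy μ f g θ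
    = potential μ θ * (sin θ * f θ ^ 2) + sin θ * (g θ + cos θ * f θ / (2 * sin θ)) ^ 2 := by
  have := sin_sq_add_cos_sq θ
  rw [energy, potential]
  field_simp
  linear_combination (-4 * f θ ^ 2) * this

theorem hasDerivAt_energy (h : IsPolarLegendre μ f g) {θ : ℝ} (hs : sin θ ≠ 0) :
    HasDerivAt (energy μ f g) (-(f θ ^ 2 * cos θ / (2 * sin θ ^ 2))) θ := by
  have hf := h.hasDerivAt_fst θ
  have hg := h.hasDerivAt_snd θ hs
  have h1 := (hasDerivAt_sin θ).mul (hg.pow 2)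
  have h2 := ((hasDerivAt_sin θ).const_mul (μ ^ 2)).mul (hf.pow 2)
  have h3 := ((hasDerivAt_cos θ).mul hf).mul hg
  have h4 := (hf.pow 2).div ((hasDerivAt_sin θ).const_mul 2) (by simpa using hs)
  refine (((h1.add h2).add h3).add h4).congr_deriv ?_
  have := sin_sq_add_cos_sq θ
  simp only [Pi.mul_apply, Pi.pow_apply]
  field_simp
  linear_combination (-2 * f θ * g θ * sin θ) * this

theorem hasDerivAt_potential (μ : ℝ) {θ : ℝ} (hs : sin θ ≠ 0) :
    HasDerivAt (potential μ) (-(cos θ / (2 * sin θ ^ 3))) θ := by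
  have h1 := (((hasDerivAt_sin θ).pow 2).const_mul 4).inv (by simpa using hs)
  have h2 := h1.const_add (μ ^ 2 + 1 / 4)
  have e : potential μ = fun θ => μ ^ 2 + 1 / 4 + (4 * sin θ ^ 2)⁻¹ := by
    funext t
    rw [potential, one_div (4 * _)]
  rw [e]
  refine h2.congr_deriv ?_
  simp only [Pi.pow_apply]
  field_simp
  ring

theorem sq_le_potential (μ θ : ℝ) : μ ^ 2 ≤ potential μ θ := by
  have : 0 ≤ 1 / (4 * sin θ ^ 2) := by positivity
  rw [potential]
  linarith

/-- On `[1 / (2 μ), π / 2]` the sine is at least half the angle, hence at least `1 / (4 μ)`. -/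
theorem sin_lower {θ : ℝ} (hμ : 1 ≤ μ) (hθ : θ ∈ Set.Icc (1 / (2 * μ)) (π / 2)) :
    0 < sin θ ∧ 1 ≤ 4 * (μ * sin θ) := by
  have h0 : 0 < 1 / (2 * μ) := by positivity
  have h1 : 1 / 2 * θ ≤ sin θ := by
    refine le_trans ?_ (mul_le_sin (h0.le.trans hθ.1) hθ.2)
    refine mul_le_mul_of_nonneg_right ?_ (h0.le.trans hθ.1)
    rw [div_le_div_iff₀ two_pos pi_pos]
    linarith [pi_lt_four]
  have h2 : μ * (1 / (2 * μ)) ≤ μ * θ := by gcongr; exact hθ.1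
  have h3 : μ * (1 / (2 * μ)) = 1 / 2 := by field_simp
  have h4 : μ * (1 / 2 * θ) ≤ μ * sin θ := by gcongr
  exact ⟨by linarith [hθ.1], by linarith⟩

theorem antitoneOn_energy (h : IsPolarLegendre μ f g) :
    AntitoneOn (energy μ f g) (Set.Icc (1 / (2 * μ)) (π / 2)) := by
  have hs : ∀ θ ∈ Set.Icc (1 / (2 * μ)) (π / 2), sin θ ≠ 0 :=
    fun θ hθ => (sin_lower h.one_le hθ).1.ne'
  refine antitoneOn_of_deriv_nonpos (convex_Icc _ _)
    (fun θ hθ => (h.hasDerivAt_energy (hs θ hθ)).continuousAt.continuousWithinAt)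
    (fun θ hθ => (h.hasDerivAt_energy
      (hs θ (interior_subset hθ))).differentiableAt.differentiableWithinAt) fun θ hθ => ?_
  have hθ' := interior_subset hθ
  rw [(h.hasDerivAt_energy (hs θ hθ')).deriv]
  have : 0 ≤ cos θ := cos_nonneg_of_mem_Icc
    ⟨by linarith [(by have := h.one_le; positivity : 0 < 1 / (2 * μ)), hθ'.1, pi_pos], hθ'.2⟩
  have := (sin_lower h.one_le hθ').1
  rw [neg_nonpos]
  positivity

/-- Sonin's monotonicity: the derivative of `u² + u'² / q` is `-u'² q' / q²`, and `q` decreases. -/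
theorem monotoneOn_energy_div_potential (h : IsPolarLegendre μ f g) :
    MonotoneOn (fun θ => energy μ f g θ / potential μ θ) (Set.Icc (1 / (2 * μ)) (π / 2)) := by
  have hs : ∀ θ ∈ Set.Icc (1 / (2 * μ)) (π / 2), sin θ ≠ 0 :=
    fun θ hθ => (sin_lower h.one_le hθ).1.ne'
  have hq : ∀ θ, 0 < potential μ θ := fun θ =>
    lt_of_lt_of_le (by have := h.one_le; positivity) (sq_le_potential μ θ)
  have hd : ∀ θ ∈ Set.Icc (1 / (2 * μ)) (π / 2), _ := fun θ hθ =>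
    (h.hasDerivAt_energy (hs θ hθ)).div (hasDerivAt_potential μ (hs θ hθ)) (hq θ).ne'
  refine monotoneOn_of_deriv_nonneg (convex_Icc _ _)
    (fun θ hθ => (hd θ hθ).continuousAt.continuousWithinAt)
    (fun θ hθ => (hd θ (interior_subset hθ)).differentiableAt.differentiableWithinAt)
    fun θ hθ => ?_
  have hθ' := interior_subset hθ
  refine le_of_le_of_eq ?_ (hd θ hθ').deriv.symm
  have hc : 0 ≤ cos θ := cos_nonneg_of_mem_Icc
    ⟨by linarith [(by have := h.one_le; positivity : 0 < 1 / (2 * μ)), hθ'.1, pi_pos], hθ'.2⟩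
  have hsin := (sin_lower h.one_le hθ').1
  refine div_nonneg (le_of_le_of_eq (b := cos θ / (2 * sin θ ^ 3)
    * (sin θ * (g θ + cos θ * f θ / (2 * sin θ)) ^ 2)) (by positivity) ?_) (by positivity)
  rw [energy_eq hsin.ne']
  field_simp
  ring

theorem energy_le (h : IsPolarLegendre μ f g) {θ : ℝ}
    (hθ : θ ∈ Set.Icc (1 / (2 * μ)) (π / 2)) : energy μ f g θ ≤ 4 * μ := by
  have hμ := h.one_le
  have ha0 : 0 < 1 / (2 * μ) := by positivity
  have hle : 1 / (2 * μ) ≤ π / 2 := hθ.1.trans hθ.2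
  have ha : 1 / (2 * μ) ∈ Set.Icc (1 / (2 * μ)) (π / 2) := ⟨le_rfl, hle⟩
  refine (h.antitoneOn_energy ha hθ hθ.1).trans ?_
  obtain ⟨hs, hs'⟩ := sin_lower hμ ha
  have hf := h.sq_fst_le _ ⟨ha0.le, hle⟩
  have hg := h.sq_snd_le _ ⟨ha0.le, hle⟩
  have hsa : sin (1 / (2 * μ)) ≤ 1 / (2 * μ) := sin_le ha0.le
  have hsμ : μ * sin (1 / (2 * μ)) ≤ 1 / 2 :=
    (mul_le_mul_of_nonneg_left hsa (by positivity)).trans_eq (by field_simp)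
  generalize 1 / (2 * μ) = a at *
  have hμ0 : 0 < μ := by linarith
  have b1 : sin a * g a ^ 2 ≤ μ / 2 :=
    calc sin a * g a ^ 2 ≤ sin a * μ ^ 2 := by gcongr
      _ = μ * (μ * sin a) := by ring
      _ ≤ μ * (1 / 2) := by gcongr
      _ = μ / 2 := by ring
  have b2 : μ ^ 2 * sin a * f a ^ 2 ≤ μ / 2 :=
    calc μ ^ 2 * sin a * f a ^ 2 ≤ μ ^ 2 * sin a * 1 := by gcongr
      _ = μ * (μ * sin a) := by ring
      _ ≤ μ * (1 / 2) := by gcongr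
      _ = μ / 2 := by ring
  have b3 : cos a * f a * g a ≤ μ := by
    have hc : cos a ^ 2 * g a ^ 2 ≤ 1 * μ ^ 2 := by
      gcongr
      exact cos_sq_le_one a
    nlinarith [sq_nonneg (μ * f a - cos a * g a), mul_le_mul_of_nonneg_left hf (sq_nonneg μ)]
  have b4 : f a ^ 2 / (2 * sin a) ≤ 2 * μ := by
    rw [div_le_iff₀ (by positivity)]
    linarith
  rw [energy]
  linarith

theorem sin_mul_sq_fst_le (h : IsPolarLegendre μ f g) {θ : ℝ} (hθ : θ ∈ Set.Icc 0 (π / 2)) :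
    sin θ * f θ ^ 2 ≤ 4 / μ := by
  have hμ := h.one_le
  have hμ0 : 0 < μ := by linarith
  rcases le_total θ (1 / (2 * μ)) with hle | hle
  · have hs : 0 ≤ sin θ := sin_nonneg_of_nonneg_of_le_pi hθ.1 (by linarith [hθ.2, pi_pos])
    calc sin θ * f θ ^ 2 ≤ sin θ * 1 := by gcongr; exact h.sq_fst_le θ hθ
      _ ≤ 1 / (2 * μ) := by linarith [sin_le hθ.1]
      _ ≤ 4 / μ := by
        rw [div_le_div_iff₀ (by positivity) hμ0]
        linarith
  · have hθ' : θ ∈ Set.Icc (1 / (2 * μ)) (π / 2) := ⟨hle, hθ.2⟩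
    have hs := (sin_lower hμ hθ').1
    have he := h.energy_le hθ'
    rw [energy_eq hs.ne'] at he
    have h1 : 0 ≤ sin θ * (g θ + cos θ * f θ / (2 * sin θ)) ^ 2 := by positivity
    have h2 : μ ^ 2 * (sin θ * f θ ^ 2) ≤ potential μ θ * (sin θ * f θ ^ 2) := by
      gcongr
      exact sq_le_potential μ θ
    rw [le_div_iff₀ hμ0]
    nlinarith

theorem sin_mul_sq_snd_le (h : IsPolarLegendre μ f g) {θ : ℝ}
    (hθ : θ ∈ Set.Icc (1 / (2 * μ)) (π / 2)) : sin θ * g θ ^ 2 ≤ 40 * μ := by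
  have hμ := h.one_le
  have hμ0 : 0 < μ := by linarith
  obtain ⟨hs, hs'⟩ := sin_lower hμ hθ
  have he := h.energy_le hθ
  have hf := h.sin_mul_sq_fst_le (θ := θ) ⟨le_trans (by positivity) hθ.1, hθ.2⟩
  rw [energy_eq hs.ne'] at he
  have h1 : 0 ≤ potential μ θ * (sin θ * f θ ^ 2) :=
    mul_nonneg ((sq_nonneg μ).trans (sq_le_potential μ θ)) (by positivity)
  set w := cos θ * f θ / (2 * sin θ) with hw
  have h2 : sin θ * w ^ 2 ≤ 16 * μ := by
    have e : sin θ * w ^ 2 = cos θ ^ 2 * (sin θ * f θ ^ 2) / (4 * sin θ ^ 2) := by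
      rw [hw]
      field_simp
      ring
    rw [e, div_le_iff₀ (by positivity)]
    calc cos θ ^ 2 * (sin θ * f θ ^ 2) ≤ 1 * (4 / μ) := by
          gcongr
          exact cos_sq_le_one θ
      _ ≤ 4 / μ * (4 * (μ * sin θ)) ^ 2 := by
          rw [one_mul]
          exact le_mul_of_one_le_right (by positivity) (one_le_pow₀ hs')
      _ = 16 * μ * (4 * sin θ ^ 2) := by
          field_simp
          ring
  nlinarith [mul_nonneg hs.le (sq_nonneg (g θ + 2 * w))]

theorem abs_sin_mul_fst_mul_snd_le (h : IsPolarLegendre μ f g) {θ : ℝ}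
    (hθ : θ ∈ Set.Icc (1 / (2 * μ)) (π / 2)) : |sin θ * f θ * g θ| ≤ 22 := by
  have hμ := h.one_le
  have hμ0 : 0 < μ := by linarith
  obtain ⟨hs, hs'⟩ := sin_lower hμ hθ
  have hf := h.sin_mul_sq_fst_le (θ := θ) ⟨le_trans (by positivity) hθ.1, hθ.2⟩
  have hg := h.sin_mul_sq_snd_le hθ
  rw [le_div_iff₀ hμ0] at hf
  have h1 := mul_nonneg hs.le (sq_nonneg (μ * f θ - g θ))
  have h2 := mul_nonneg hs.le (sq_nonneg (μ * f θ + g θ))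
  rw [abs_le]
  constructor <;> nlinarith

theorem energy_ge (h : IsPolarLegendre μ f g) {θ : ℝ}
    (hθ : θ ∈ Set.Icc (1 / (2 * μ)) (π / 2)) : μ / 16 ≤ energy μ f g θ := by
  have hμ := h.one_le
  have hμ0 : 0 < μ := by linarith
  have ha0 : 0 < 1 / (2 * μ) := by positivity
  have hle : 1 / (2 * μ) ≤ π / 2 := hθ.1.trans hθ.2
  have ha : 1 / (2 * μ) ∈ Set.Icc (1 / (2 * μ)) (π / 2) := ⟨le_rfl, hle⟩
  have hmono := h.monotoneOn_energy_div_potential ha hθ hθ.1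
  obtain ⟨hs, hs'⟩ := sin_lower hμ ha
  -- the point `1 / (2 μ)` is so close to `0` that the slope bound `μ` keeps `f` above `1 / 2`
  -- the point `1 / (2 μ)` is so close to `0` that the slope bound `μ` keeps `f` above `1 / 2`
  have hfa : 1 / 2 ≤ f (1 / (2 * μ)) := by
    have hmv := (convex_Icc 0 (1 / (2 * μ))).norm_image_sub_le_of_norm_hasDerivWithin_le (C := μ)
      (fun x _ => (h.hasDerivAt_fst x).hasDerivWithinAt)
      (fun x hx => abs_le_of_sq_le_sq (h.sq_snd_le x ⟨hx.1, hx.2.trans hle⟩) hμ0.le)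
      (Set.left_mem_Icc.2 ha0.le) (Set.right_mem_Icc.2 ha0.le)
    rw [h.fst_zero, sub_zero, norm_of_nonneg ha0.le, mul_one_div, div_mul_cancel_right₀ hμ0.ne',
      Real.norm_eq_abs] at hmv
    linarith [(abs_le.1 hmv).1]
  have hq : ∀ θ, 0 < potential μ θ := fun θ =>
    lt_of_lt_of_le (by positivity) (sq_le_potential μ θ)
  have hlow : 1 / (16 * μ) ≤ energy μ f g (1 / (2 * μ)) / potential μ (1 / (2 * μ)) := by
    rw [le_div_iff₀ (hq _), energy_eq hs.ne', mul_comm]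
    refine le_trans ?_ (le_add_of_nonneg_right (by positivity))
    refine mul_le_mul_of_nonneg_left ?_ (hq _).le
    generalize 1 / (2 * μ) = a at *
    rw [div_le_iff₀ (by positivity)]
    have : 1 ≤ 4 * f a ^ 2 := by nlinarith
    nlinarith
  have h3 := hlow.trans hmono
  simp only [] at h3
  rw [le_div_iff₀ (hq _)] at h3
  refine le_trans ?_ h3
  calc μ / 16 = 1 / (16 * μ) * μ ^ 2 := by field_simp
    _ ≤ _ := by gcongr; exact sq_le_potential μ θ

theorem continuous_fst (h : IsPolarLegendre μ f g) : Continuous f :=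
  continuous_iff_continuousAt.2 fun θ => (h.hasDerivAt_fst θ).continuousAt

theorem integral_le (h : IsPolarLegendre μ f g) {R : ℝ} (hR : R ∈ Set.Icc 0 (π / 2)) :
    ∫ θ in 0..R, sin θ * f θ ^ 2 ≤ 4 / μ * R := by
  have hc := h.continuous_fst
  have := intervalIntegral.integral_mono_on (μ := volume) hR.1
    (f := fun θ => sin θ * f θ ^ 2) (g := fun _ => 4 / μ)
    (Continuous.intervalIntegrable (by fun_prop) _ _)
    (Continuous.intervalIntegrable (by fun_prop) _ _)
    (fun θ hθ => h.sin_mul_sq_fst_le ⟨hθ.1, hθ.2.trans hR.2⟩)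
  refine this.trans_eq ?_
  rw [intervalIntegral.integral_const, smul_eq_mul, sub_zero, mul_comm]

/-- The energy is comparable to `μ`, and up to the derivative of the bounded function
`sin θ f f'` it is dominated by `μ² sin θ f²`; so the integral of the latter grows linearly. -/
theorem le_integral (h : IsPolarLegendre μ f g) {R : ℝ} (hR : R ≤ π / 2) (hμR : 2848 ≤ μ * R) :
    R / (480 * μ) ≤ ∫ θ in 0..R, sin θ * f θ ^ 2 := by
  have hμ := h.one_le
  have hμ0 : 0 < μ := by linarith
  have ha0 : 0 < 1 / (2 * μ) := by positivity
  -- the interval starts at `1 / (2 μ)`: below it the energy is not comparable to `μ`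
  -- the interval starts at `1 / (2 μ)`: below it the energy is not comparable to `μ`
  have haR : 1 / (2 * μ) ≤ R := by
    rw [div_le_iff₀ (by positivity)]
    linarith
  have hc := h.continuous_fst
  have hcont : Continuous fun θ => sin θ * f θ ^ 2 := by fun_prop
  have hd : ∀ θ ∈ Set.Icc (1 / (2 * μ)) R, HasDerivAt
      (fun θ => 15 * μ ^ 2 * (∫ t in 0..θ, sin t * f t ^ 2) + 2 * (sin θ * f θ * g θ) - μ / 16 * θ)
      (15 * μ ^ 2 * (sin θ * f θ ^ 2) + 2 * (sin θ * g θ ^ 2 - μ ^ 2 * (sin θ * f θ ^ 2))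
        - μ / 16) θ := by
    intro θ hθ
    have hs := (sin_lower hμ ⟨hθ.1, hθ.2.trans hR⟩).1.ne'
    have h1 := (hcont.integral_hasStrictDerivAt 0 θ).hasDerivAt.const_mul (15 * μ ^ 2)
    have h2 := ((((hasDerivAt_sin θ).mul (h.hasDerivAt_fst θ)).mul
      (h.hasDerivAt_snd θ hs)).const_mul 2)
    refine ((h1.add h2).sub ((hasDerivAt_id θ).const_mul (μ / 16))).congr_deriv ?_
    simp only [Pi.mul_apply]
    field_simp
    ring
  have hmono := monotoneOn_of_deriv_nonneg (convex_Icc (1 / (2 * μ)) R)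
    (fun θ hθ => (hd θ hθ).continuousAt.continuousWithinAt)
    (fun θ hθ => (hd θ (interior_subset hθ)).differentiableAt.differentiableWithinAt)
    (fun θ hθ => by
      have hθ' : θ ∈ Set.Icc (1 / (2 * μ)) (π / 2) :=
        ⟨(interior_subset hθ).1, (interior_subset hθ).2.trans hR⟩
      rw [(hd θ (interior_subset hθ)).deriv]
      obtain ⟨hs, hs'⟩ := sin_lower hμ hθ'
      have he := h.energy_ge hθ'
      rw [energy] at he
      have b1 : f θ ^ 2 / (2 * sin θ) ≤ 8 * μ ^ 2 * (sin θ * f θ ^ 2) := by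
        rw [div_le_iff₀ (by positivity)]
        have := one_le_pow₀ hs' (n := 2)
        nlinarith [mul_le_mul_of_nonneg_left this (sq_nonneg (f θ))]
      have b2 : cos θ * f θ * g θ ≤ sin θ * g θ ^ 2 + f θ ^ 2 / (2 * sin θ) / 2 := by
        have : f θ ^ 2 / (2 * sin θ) / 2 = f θ ^ 2 / (4 * sin θ) := by
          field_simp
          ring
        rw [this, ← sub_nonneg]
        have e : sin θ * g θ ^ 2 + f θ ^ 2 / (4 * sin θ) - cos θ * f θ * g θ
            = (sin θ * g θ - cos θ * f θ / 2) ^ 2 / sin θ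
              + sin θ * f θ ^ 2 / 4 := by
          have := sin_sq_add_cos_sq θ
          field_simp
          linear_combination (-4 * f θ ^ 2) * this
        rw [e]
        positivity
      linarith)
  have hfin := hmono ⟨le_rfl, haR⟩ ⟨haR, le_rfl⟩ haR
  simp only [] at hfin
  have hpos : 0 ≤ ∫ t in 0..(1 / (2 * μ)), sin t * f t ^ 2 := by
    refine intervalIntegral.integral_nonneg ha0.le fun t ht => ?_
    have : 0 ≤ sin t := sin_nonneg_of_nonneg_of_le_pi ht.1
      (by linarith [ht.2, pi_pos])
    positivity
  have hpos' : 0 ≤ 15 * μ ^ 2 * ∫ t in 0..(1 / (2 * μ)), sin t * f t ^ 2 := by positivity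
  have ba := abs_le.1 (h.abs_sin_mul_fst_mul_snd_le ⟨le_rfl, haR.trans hR⟩)
  have bR := abs_le.1 (h.abs_sin_mul_fst_mul_snd_le ⟨haR, hR⟩)
  have e1 : μ / 16 * (1 / (2 * μ)) = 1 / 32 := by
    field_simp
    norm_num
  rw [e1] at hfin
  rw [div_le_iff₀ (by positivity)]
  -- the boundary terms amount to at most `2 * 22 + 2 * 22 + 1 / 32 ≤ 89 ≤ μ R / 32`
  -- the boundary terms amount to at most `2 * 22 + 2 * 22 + 1 / 32 ≤ 89 ≤ μ R / 32`
  have : μ * R / 32 ≤ 15 * μ ^ 2 * ∫ t in 0..R, sin t * f t ^ 2 := by linarith [ba.1, bR.2]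
  nlinarith

end IsPolarLegendre

end LegendreSize

/-! ### The area measure of the sphere -/

section SphereArea

open Set
open scoped Pointwise ENNReal

instance : IsFiniteMeasure area := by
  rw [area]
  infer_instance

/-- The action of a linear isometry on the unit sphere. -/
noncomputable def sphereMap
    (R : EuclideanSpace ℝ (Fin 3) ≃ₗᵢ[ℝ] EuclideanSpace ℝ (Fin 3)) (x : S2) : S2 :=
  ⟨R x, by simp⟩

@[simp]
theorem coe_sphereMap (R : EuclideanSpace ℝ (Fin 3) ≃ₗᵢ[ℝ] EuclideanSpace ℝ (Fin 3)) (x : S2) :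
    (sphereMap R x : EuclideanSpace ℝ (Fin 3)) = R x := rfl

theorem continuous_sphereMap (R : EuclideanSpace ℝ (Fin 3) ≃ₗᵢ[ℝ] EuclideanSpace ℝ (Fin 3)) :
    Continuous (sphereMap R) :=
  (R.continuous.comp continuous_subtype_val).subtype_mk _

theorem measurePreserving_sphereMap
    (R : EuclideanSpace ℝ (Fin 3) ≃ₗᵢ[ℝ] EuclideanSpace ℝ (Fin 3)) :
    MeasurePreserving (sphereMap R) area area := by
  refine ⟨(continuous_sphereMap R).measurable, Measure.ext fun s hs => ?_⟩
  rw [Measure.map_apply (continuous_sphereMap R).measurable hs, area,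
    Measure.toSphere_apply' _ ((continuous_sphereMap R).measurable hs),
    Measure.toSphere_apply' _ hs]
  congr 1
  have e : Ioo (0 : ℝ) 1 • ((↑) '' (sphereMap R ⁻¹' s) : Set (EuclideanSpace ℝ (Fin 3)))
      = R.toHomeomorph.toMeasurableEquiv ⁻¹' (Ioo (0 : ℝ) 1 • ((↑) '' s)) := by
    ext v
    simp only [mem_smul, mem_image, mem_preimage]
    constructor
    · rintro ⟨t, ht, -, ⟨x, hx, rfl⟩, rfl⟩
      exact ⟨t, ht, _, ⟨_, hx, rfl⟩, (R.map_smul t _).symm⟩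
    · rintro ⟨t, ht, -, ⟨x, hx, rfl⟩, h⟩
      refine ⟨t, ht, _, ⟨sphereMap R.symm x, ?_, rfl⟩, ?_⟩
      · have : sphereMap R (sphereMap R.symm x) = x := Subtype.ext (by simp)
        rwa [this]
      · rw [coe_sphereMap, ← R.symm.map_smul, h]
        exact R.symm_apply_apply v
  rw [e]
  exact R.measurePreserving.measure_preimage_equiv (f := R.toHomeomorph.toMeasurableEquiv) _

/-- Any two pairs of points of the sphere at the same distance are related by an isometry, a product
of two reflections. -/
theorem exists_sphereMap_eq {x y x' y' : S2}
    (h : inner ℝ (x : EuclideanSpace ℝ (Fin 3)) y = inner ℝ (x' : EuclideanSpace ℝ (Fin 3)) y') :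
    ∃ R, sphereMap R x = x' ∧ sphereMap R y = y' := by
  have hn : ∀ v w : S2, ‖(v : EuclideanSpace ℝ (Fin 3))‖ = ‖(w : EuclideanSpace ℝ (Fin 3))‖ :=
    fun v w => by simp
  set R₁ := (ℝ ∙ ((y : EuclideanSpace ℝ (Fin 3)) - y'))ᗮ.reflection with hR₁
  have h1 : R₁ y = y' := Submodule.reflection_sub (hn y y')
  set R₂ := (ℝ ∙ (R₁ (x : EuclideanSpace ℝ (Fin 3)) - x'))ᗮ.reflection with hR₂
  have h2 : R₂ (R₁ x) = x' := Submodule.reflection_sub (by simp)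
  have h3 : R₂ (y' : EuclideanSpace ℝ (Fin 3)) = y' := by
    refine Submodule.reflection_mem_subspace_eq_self ?_
    rw [Submodule.mem_orthogonal_singleton_iff_inner_right, inner_sub_left, ← h, ← h1,
      R₁.inner_map_map, sub_self]
  exact ⟨R₁.trans R₂, Subtype.ext h2, Subtype.ext ((congrArg R₂ h1).trans h3)⟩

theorem lintegral_sq_add_sq {G : ℝ → ℝ≥0∞} (hG : Measurable G) :
    ∫⁻ p : ℝ × ℝ, G (p.1 ^ 2 + p.2 ^ 2)
      = ENNReal.ofReal (2 * Real.pi) * ∫⁻ ρ, ENNReal.ofReal ρ * G (ρ ^ 2) := by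
  rw [← lintegral_comp_polarCoord_symm, polarCoord_target, Measure.volume_eq_prod,
    ← Measure.prod_restrict, lintegral_prod _ (by
      refine Measurable.aemeasurable ?_
      simp only [polarCoord_symm_apply]
      fun_prop)]
  have e : ∀ ρ θ : ℝ, (ρ * Real.cos θ) ^ 2 + (ρ * Real.sin θ) ^ 2 = ρ ^ 2 := fun ρ θ => by
    linear_combination ρ ^ 2 * Real.sin_sq_add_cos_sq θ
  simp only [polarCoord_symm_apply, e, lintegral_const, Measure.restrict_apply_univ,
    Real.volume_Ioo, smul_eq_mul]
  rw [lintegral_mul_const _ (by fun_prop), mul_comm, sub_neg_eq_add, ← two_mul,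
    setLIntegral_eq_of_support_subset]
  intro ρ hρ
  by_contra h
  simp [ENNReal.ofReal_of_nonpos (not_lt.1 h)] at hρ

/-- Integration over space of a function invariant under the rotations about the first axis, in
polar coordinates; the sign of `sin θ` restricts the integral to `0 < θ < π`. -/
theorem lintegral_axial {F : ℝ → ℝ → ℝ≥0∞} (hF : Measurable (Function.uncurry F)) :
    ∫⁻ v : EuclideanSpace ℝ (Fin 3), F (v 0) (v 1 ^ 2 + v 2 ^ 2)
      = ENNReal.ofReal (2 * Real.pi) * ∫⁻ r in Ioi (0 : ℝ), ∫⁻ θ in Ioo (-Real.pi) Real.pi,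
        ENNReal.ofReal r * (ENNReal.ofReal (r * Real.sin θ)
          * F (r * Real.cos θ) ((r * Real.sin θ) ^ 2)) := by
  have hF' : ∀ {α : Type} [MeasurableSpace α] {a b : α → ℝ}, Measurable a → Measurable b →
      Measurable fun t => F (a t) (b t) := fun ha hb => hF.comp (ha.prodMk hb)
  have e1 : ∫⁻ v : EuclideanSpace ℝ (Fin 3), F (v 0) (v 1 ^ 2 + v 2 ^ 2)
      = ∫⁻ v : Fin 3 → ℝ, F (v 0) (v 1 ^ 2 + v 2 ^ 2) :=
    (PiLp.volume_preserving_ofLp (Fin 3)).lintegral_comp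
      (f := fun v : Fin 3 → ℝ => F (v 0) (v 1 ^ 2 + v 2 ^ 2))
      (hF' (by fun_prop) (by fun_prop))
  have e2 : ∫⁻ v : Fin 3 → ℝ, F (v 0) (v 1 ^ 2 + v 2 ^ 2)
      = ∫⁻ p : ℝ × (Fin 2 → ℝ), F p.1 (p.2 0 ^ 2 + p.2 1 ^ 2) :=
    (volume_preserving_piFinSuccAbove (fun _ : Fin 3 => ℝ) 0).lintegral_comp
      (f := fun p : ℝ × (Fin 2 → ℝ) => F p.1 (p.2 0 ^ 2 + p.2 1 ^ 2))
      (hF' (by fun_prop) (by fun_prop))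
  have e3 : ∀ z : ℝ, ∫⁻ w : Fin 2 → ℝ, F z (w 0 ^ 2 + w 1 ^ 2)
      = ∫⁻ p : ℝ × ℝ, F z (p.1 ^ 2 + p.2 ^ 2) := fun z =>
    (volume_preserving_finTwoArrow ℝ).lintegral_comp
      (f := fun p : ℝ × ℝ => F z (p.1 ^ 2 + p.2 ^ 2))
      (hF' (by fun_prop) (by fun_prop))
  rw [e1, e2, Measure.volume_eq_prod,
    lintegral_prod _ (hF' (by fun_prop) (by fun_prop)).aemeasurable]
  simp only [e3]
  have e4 : ∀ z : ℝ, ∫⁻ p : ℝ × ℝ, F z (p.1 ^ 2 + p.2 ^ 2) = _ :=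
    fun z => lintegral_sq_add_sq (G := F z) (hF' (by fun_prop) (by fun_prop))
  simp only [e4]
  have hm : Measurable fun p : ℝ × ℝ => ENNReal.ofReal p.2 * F p.1 (p.2 ^ 2) :=
    Measurable.mul (by fun_prop) (hF' (by fun_prop) (by fun_prop))
  rw [lintegral_const_mul _ hm.lintegral_prod_right', ← lintegral_prod _ hm.aemeasurable,
    ← Measure.volume_eq_prod, ← lintegral_comp_polarCoord_symm, polarCoord_target,
    Measure.volume_eq_prod, ← Measure.prod_restrict, lintegral_prod _ (by
      refine Measurable.aemeasurable ?_
      simp only [polarCoord_symm_apply]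
      exact Measurable.mul (by fun_prop) (Measurable.mul (by fun_prop)
        (hF' (by fun_prop) (by fun_prop))))]
  simp only [polarCoord_symm_apply, smul_eq_mul]

/-- The cone over the points of the sphere with first coordinate in `T`. -/
theorem mem_cone_iff {T : Set ℝ} {v : EuclideanSpace ℝ (Fin 3)} :
    v ∈ Ioo (0 : ℝ) 1 • ((↑) '' {x : S2 | (x : EuclideanSpace ℝ (Fin 3)) 0 ∈ T} :
      Set (EuclideanSpace ℝ (Fin 3))) ↔ 0 < ‖v‖ ∧ ‖v‖ < 1 ∧ v 0 / ‖v‖ ∈ T := by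
  simp only [mem_smul, mem_image]
  constructor
  · rintro ⟨t, ht, -, ⟨x, hx, rfl⟩, rfl⟩
    have hn : ‖t • (x : EuclideanSpace ℝ (Fin 3))‖ = t := by
      simp [norm_smul, abs_of_pos ht.1]
    rw [hn]
    refine ⟨ht.1, ht.2, ?_⟩
    have : (t • (x : EuclideanSpace ℝ (Fin 3))) 0 / t = (x : EuclideanSpace ℝ (Fin 3)) 0 := by
      simp [ht.1.ne']
    rwa [this]
  · rintro ⟨h0, h1, h2⟩
    refine ⟨‖v‖, ⟨h0, h1⟩, _, ⟨⟨‖v‖⁻¹ • v, ?_⟩, ?_, rfl⟩, ?_⟩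
    · simp [norm_smul, h0.ne']
    · change (‖v‖⁻¹ • v) 0 ∈ T
      rwa [PiLp.smul_apply, smul_eq_mul, inv_mul_eq_div]
    · simp [smul_smul, h0.ne']

theorem area_setOf_coord_mem {T : Set ℝ} (hT : MeasurableSet T) :
    area {x : S2 | (x : EuclideanSpace ℝ (Fin 3)) 0 ∈ T}
      = ENNReal.ofReal (2 * Real.pi) * ∫⁻ θ in Ioo (-Real.pi) Real.pi,
        ENNReal.ofReal (Real.sin θ) * T.indicator 1 (Real.cos θ) := by
  have hms : MeasurableSet {x : S2 | (x : EuclideanSpace ℝ (Fin 3)) 0 ∈ T} := by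
    have : Measurable fun x : S2 => (x : EuclideanSpace ℝ (Fin 3)) 0 := by fun_prop
    exact this hT
  set U : Set (ℝ × ℝ) := {p | 0 < √(p.1 ^ 2 + p.2) ∧ √(p.1 ^ 2 + p.2) < 1 ∧
    p.1 / √(p.1 ^ 2 + p.2) ∈ T} with hU
  have hUm : MeasurableSet U := by
    have h1 : Measurable fun p : ℝ × ℝ => √(p.1 ^ 2 + p.2) := by fun_prop
    have h2 : Measurable fun p : ℝ × ℝ => p.1 / √(p.1 ^ 2 + p.2) := by fun_prop
    exact (measurableSet_lt measurable_const h1).inter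
      ((measurableSet_lt h1 measurable_const).inter (h2 hT))
  set F : ℝ → ℝ → ℝ≥0∞ := fun a b => U.indicator 1 (a, b) with hF
  have hFm : Measurable (Function.uncurry F) := by
    have : Function.uncurry F = U.indicator 1 := rfl
    rw [this]
    exact measurable_one.indicator hUm
  have hcone : (volume : Measure (EuclideanSpace ℝ (Fin 3)))
      (Ioo (0 : ℝ) 1 • ((↑) '' {x : S2 | (x : EuclideanSpace ℝ (Fin 3)) 0 ∈ T}))
      = ∫⁻ v : EuclideanSpace ℝ (Fin 3), F (v 0) (v 1 ^ 2 + v 2 ^ 2) := by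
    have hm : MeasurableSet {v : EuclideanSpace ℝ (Fin 3) | (v 0, v 1 ^ 2 + v 2 ^ 2) ∈ U} := by
      have : Measurable fun v : EuclideanSpace ℝ (Fin 3) => (v 0, v 1 ^ 2 + v 2 ^ 2) := by
        fun_prop
      exact this hUm
    rw [show Ioo (0 : ℝ) 1 • ((↑) '' {x : S2 | (x : EuclideanSpace ℝ (Fin 3)) 0 ∈ T})
      = {v : EuclideanSpace ℝ (Fin 3) | (v 0, v 1 ^ 2 + v 2 ^ 2) ∈ U} by
        ext v
        refine mem_cone_iff.trans ?_
        rw [EuclideanSpace.norm_eq, Fin.sum_univ_three]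
        simp only [Real.norm_eq_abs, sq_abs, add_assoc]
        rfl, ← lintegral_indicator_one hm]
    rfl
  rw [area, Measure.toSphere_apply' _ hms, hcone, lintegral_axial hFm]
  have hFr : ∀ r ∈ Ioi (0 : ℝ), ∀ θ, ENNReal.ofReal r * (ENNReal.ofReal (r * Real.sin θ)
      * F (r * Real.cos θ) ((r * Real.sin θ) ^ 2))
      = (Iio (1 : ℝ)).indicator (fun r => ENNReal.ofReal (r ^ 2)) r
        * (ENNReal.ofReal (Real.sin θ) * T.indicator 1 (Real.cos θ)) := by
    intro r (hr : 0 < r) θ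
    have e : √((r * Real.cos θ) ^ 2 + (r * Real.sin θ) ^ 2) = r := by
      rw [show (r * Real.cos θ) ^ 2 + (r * Real.sin θ) ^ 2 = r ^ 2 by
        linear_combination r ^ 2 * Real.sin_sq_add_cos_sq θ, Real.sqrt_sq hr.le]
    have e2 : F (r * Real.cos θ) ((r * Real.sin θ) ^ 2)
        = (Iio (1 : ℝ)).indicator 1 r * T.indicator 1 (Real.cos θ) := by
      have hmem : (r * Real.cos θ, (r * Real.sin θ) ^ 2) ∈ U ↔ r < 1 ∧ Real.cos θ ∈ T := by
        change 0 < √((r * Real.cos θ) ^ 2 + (r * Real.sin θ) ^ 2) ∧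
          √((r * Real.cos θ) ^ 2 + (r * Real.sin θ) ^ 2) < 1 ∧
          r * Real.cos θ / √((r * Real.cos θ) ^ 2 + (r * Real.sin θ) ^ 2) ∈ T ↔ _
        rw [e, mul_div_cancel_left₀ _ hr.ne']
        simp [hr]
      by_cases h1 : r < 1 <;> by_cases h2 : Real.cos θ ∈ T <;> simp [hF, hmem, h1, h2]
    rw [e2, ENNReal.ofReal_mul hr.le]
    by_cases h1 : r < 1
    · simp only [indicator, mem_Iio, h1, if_true, Pi.one_apply, one_mul, sq,
        ENNReal.ofReal_mul hr.le, mul_assoc]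
    · simp [h1]
  have hTm : Measurable fun θ => ENNReal.ofReal (Real.sin θ)
      * T.indicator (1 : ℝ → ℝ≥0∞) (Real.cos θ) := by
    refine Measurable.mul (by fun_prop) ?_
    exact (measurable_one.indicator hT).comp Real.measurable_cos
  rw [setLIntegral_congr_fun measurableSet_Ioi (g := fun r => ∫⁻ θ in Ioo (-Real.pi) Real.pi,
    (Iio (1 : ℝ)).indicator (fun r => ENNReal.ofReal (r ^ 2)) r
        * (ENNReal.ofReal (Real.sin θ) * T.indicator 1 (Real.cos θ)))
    (fun r hr => lintegral_congr fun θ => hFr r hr θ)]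
  simp only [lintegral_const_mul _ hTm]
  rw [lintegral_mul_const _ ((by fun_prop : Measurable fun r : ℝ =>
    ENNReal.ofReal (r ^ 2)).indicator measurableSet_Iio), lintegral_indicator measurableSet_Iio,
    Measure.restrict_restrict measurableSet_Iio]
  have hr : ∫⁻ r in Iio (1 : ℝ) ∩ Ioi 0, ENNReal.ofReal (r ^ 2) = ENNReal.ofReal (1 / 3) := by
    rw [inter_comm, Ioi_inter_Iio, Measure.restrict_congr_set Ioo_ae_eq_Ioc,
      ← ofReal_integral_eq_lintegral_ofReal
        (by exact (Continuous.intervalIntegrable (by fun_prop) (0 : ℝ) 1).1)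
        (Filter.Eventually.of_forall fun r => sq_nonneg r),
      ← intervalIntegral.integral_of_le zero_le_one, integral_pow]
    norm_num
  rw [hr, finrank_euclideanSpace_fin, mul_left_comm, ← mul_assoc (Nat.cast 3 : ℝ≥0∞)]
  congr 1
  rw [show ((3 : ℕ) : ℝ≥0∞) = ENNReal.ofReal 3 by simp, ← ENNReal.ofReal_mul (by norm_num)]
  norm_num

/-- Archimedes' theorem: in terms of the angle `θ` to a fixed point `y` the area measure is
`2 π sin θ dθ`. -/
theorem lintegral_inner_area (y : S2) {g : ℝ → ℝ≥0∞} (hg : Measurable g) :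
    ∫⁻ x : S2, g (inner ℝ (x : EuclideanSpace ℝ (Fin 3)) y) ∂area
      = ENNReal.ofReal (2 * Real.pi) *
        ∫⁻ θ in Ioo 0 Real.pi, ENNReal.ofReal (Real.sin θ) * g (Real.cos θ) := by
  set e : S2 := ⟨EuclideanSpace.single 0 1, by simp⟩ with he
  obtain ⟨R, hR, -⟩ := exists_sphereMap_eq (x := y) (y := y) (x' := e) (y' := e) (by simp)
  have h1 : ∫⁻ x : S2, g (inner ℝ (x : EuclideanSpace ℝ (Fin 3)) y) ∂area
      = ∫⁻ x : S2, g ((x : EuclideanSpace ℝ (Fin 3)) 0) ∂area := by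
    rw [← (measurePreserving_sphereMap R).lintegral_comp
      (f := fun x : S2 => g ((x : EuclideanSpace ℝ (Fin 3)) 0)) (hg.comp (by fun_prop))]
    refine lintegral_congr fun x => ?_
    congr 1
    have : inner ℝ (R (x : EuclideanSpace ℝ (Fin 3))) (R y) = _ := R.inner_map_map x y
    rw [← this, ← coe_sphereMap R y, hR, he]
    simp [EuclideanSpace.inner_single_right]
  have hm : Measurable fun x : S2 => (x : EuclideanSpace ℝ (Fin 3)) 0 := by fun_prop
  have hsin : Measurable fun θ => ENNReal.ofReal (Real.sin θ) := by fun_prop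
  have h2 : area.map (fun x : S2 => (x : EuclideanSpace ℝ (Fin 3)) 0)
      = ENNReal.ofReal (2 * Real.pi) • ((volume.restrict (Ioo (-Real.pi) Real.pi)).withDensity
        fun θ => ENNReal.ofReal (Real.sin θ)).map Real.cos := by
    ext T hT
    rw [Measure.map_apply hm hT, Measure.smul_apply, Measure.map_apply Real.measurable_cos hT,
      withDensity_apply _ (Real.measurable_cos hT), smul_eq_mul,
      ← lintegral_indicator (Real.measurable_cos hT)]
    refine (area_setOf_coord_mem hT).trans ?_
    congr 2 with θ
    by_cases h : Real.cos θ ∈ T <;> simp [h]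
  rw [h1, ← lintegral_map (f := g) hg hm, h2, lintegral_smul_measure,
    lintegral_map hg Real.measurable_cos, lintegral_withDensity_eq_lintegral_mul
      (g := fun θ => g (Real.cos θ)) _ hsin (hg.comp Real.measurable_cos), smul_eq_mul]
  congr 1
  simp only [Pi.mul_apply]
  rw [← lintegral_indicator measurableSet_Ioo, ← lintegral_indicator measurableSet_Ioo]
  refine lintegral_congr fun θ => ?_
  by_cases h0 : 0 < θ
  · by_cases h1 : θ < Real.pi
    · simp [h0, h1, (neg_lt_zero.2 Real.pi_pos).trans h0]
    · simp [h1]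
  · by_cases h1 : -Real.pi < θ
    · have : Real.sin θ ≤ 0 := Real.sin_nonpos_of_nonpos_of_neg_pi_le (not_lt.1 h0) h1.le
      simp [h0, ENNReal.ofReal_of_nonpos this]
    · simp [h0, h1]

end SphereArea

/-! ### Integration over spherical caps -/

section Caps

open Set

theorem angle_eq_arccos (z x : S2) :
    InnerProductGeometry.angle (z : EuclideanSpace ℝ (Fin 3)) x
      = Real.arccos (inner ℝ (x : EuclideanSpace ℝ (Fin 3)) z) := by
  rw [InnerProductGeometry.angle, real_inner_comm]
  simp

theorem mem_geoBall_iff {z x : S2} {r : ℝ} :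
    x ∈ geoBall z r ↔ Real.arccos (inner ℝ (x : EuclideanSpace ℝ (Fin 3)) z) < r := by
  rw [← angle_eq_arccos]
  rfl

theorem measurableSet_geoBall (z : S2) (r : ℝ) : MeasurableSet (geoBall z r) := by
  have h : geoBall z r
      = {x : S2 | Real.arccos (inner ℝ (x : EuclideanSpace ℝ (Fin 3)) z) < r} := by
    ext x
    exact mem_geoBall_iff
  rw [h]
  exact (isOpen_lt (by fun_prop) continuous_const).measurableSet

theorem geoBall_subset_geoBall {x z : S2} {r s t : ℝ} (hx : x ∈ geoBall z r) (h : r + s ≤ t) :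
    geoBall x s ⊆ geoBall z t := by
  intro y hy
  have h1 : InnerProductGeometry.angle (z : EuclideanSpace ℝ (Fin 3)) x < r := hx
  have h2 : InnerProductGeometry.angle (x : EuclideanSpace ℝ (Fin 3)) y < s := hy
  have h3 := InnerProductGeometry.angle_le_angle_add_angle (z : EuclideanSpace ℝ (Fin 3)) x y
  change InnerProductGeometry.angle (z : EuclideanSpace ℝ (Fin 3)) y < t
  linarith

theorem mem_geoBall_comm {x z : S2} {r : ℝ} : x ∈ geoBall z r ↔ z ∈ geoBall x r := by
  rw [mem_geoBall_iff, mem_geoBall_iff, real_inner_comm]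

theorem setIntegral_geoBall (y : S2) {R : ℝ} (h0 : 0 ≤ R) (hR : R ≤ Real.pi) {F : ℝ → ℝ}
    (hF : Continuous F) (hF0 : ∀ t, 0 ≤ F t) :
    ∫ x in geoBall y R, F (inner ℝ (x : EuclideanSpace ℝ (Fin 3)) y) ∂area
      = 2 * Real.pi * ∫ θ in 0..R, Real.sin θ * F (Real.cos θ) := by
  have hsin : ∀ θ ∈ Ioc 0 R, 0 ≤ Real.sin θ := fun θ hθ =>
    Real.sin_nonneg_of_nonneg_of_le_pi hθ.1.le (hθ.2.trans hR)
  rw [integral_eq_lintegral_of_nonneg_ae (Filter.Eventually.of_forall fun x => hF0 _)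
      (Continuous.aestronglyMeasurable (by fun_prop)),
    intervalIntegral.integral_of_le h0, integral_eq_lintegral_of_nonneg_ae
      ((ae_restrict_iff' measurableSet_Ioc).2 (Filter.Eventually.of_forall fun θ hθ =>
        mul_nonneg (hsin θ hθ) (hF0 _)))
      (Continuous.aestronglyMeasurable (by fun_prop))]
  have hT : MeasurableSet {t : ℝ | Real.arccos t < R} :=
    (isOpen_lt Real.continuous_arccos continuous_const).measurableSet
  have e1 : ∫⁻ x in geoBall y R,
      ENNReal.ofReal (F (inner ℝ (x : EuclideanSpace ℝ (Fin 3)) y)) ∂area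
      = ∫⁻ x : S2, {t : ℝ | Real.arccos t < R}.indicator (fun t => ENNReal.ofReal (F t))
        (inner ℝ (x : EuclideanSpace ℝ (Fin 3)) y) ∂area := by
    rw [← lintegral_indicator (measurableSet_geoBall y R)]
    refine lintegral_congr fun x => ?_
    by_cases h : x ∈ geoBall y R
    · have h' := mem_geoBall_iff.1 h
      simp [h, h']
    · have h' : ¬ Real.arccos (inner ℝ (x : EuclideanSpace ℝ (Fin 3)) y) < R :=
        fun h' => h (mem_geoBall_iff.2 h')
      simp only [h, h', indicator, mem_ofPred_eq, if_false]
  have hFm : Measurable fun t => ENNReal.ofReal (F t) := by fun_prop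
  rw [e1, lintegral_inner_area y (hFm.indicator hT), ENNReal.toReal_mul,
    ENNReal.toReal_ofReal (by positivity)]
  congr 2
  rw [← restrict_Ioo_eq_restrict_Ioc, ← lintegral_indicator measurableSet_Ioo,
    ← lintegral_indicator measurableSet_Ioo]
  refine lintegral_congr fun θ => ?_
  by_cases h : θ ∈ Ioo 0 Real.pi
  · have harc : Real.arccos (Real.cos θ) = θ := Real.arccos_cos h.1.le h.2.le
    by_cases h' : θ < R
    · have h2 : θ ∈ Ioo 0 R := ⟨h.1, h'⟩
      simp only [indicator, h, h2, if_true, mem_ofPred_eq, harc, h']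
      rw [ENNReal.ofReal_mul (hsin θ ⟨h.1, h'.le⟩)]
    · have h2 : θ ∉ Ioo 0 R := fun h2 => h' h2.2
      simp only [indicator, h, h2, if_true, if_false, mem_ofPred_eq, harc, h', mul_zero]
  · have h2 : θ ∉ Ioo 0 R := fun h2 => h ⟨h2.1, h2.2.trans_le hR⟩
    simp only [indicator, h, h2, if_false]

theorem area_real_geoBall (y : S2) {R : ℝ} (h0 : 0 ≤ R) (hR : R ≤ Real.pi) :
    area.real (geoBall y R) = 2 * Real.pi * (1 - Real.cos R) := by
  have h := setIntegral_geoBall y h0 hR (F := fun _ => 1) continuous_const fun _ => zero_le_one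
  simpa using h

theorem area_real_geoBall_le (y : S2) {R : ℝ} (h0 : 0 ≤ R) (hR : R ≤ Real.pi) :
    area.real (geoBall y R) ≤ Real.pi * R ^ 2 := by
  rw [area_real_geoBall y h0 hR]
  have := Real.one_sub_sq_div_two_le_cos (x := R)
  nlinarith [Real.pi_pos]

theorem le_area_real_geoBall (y : S2) {R : ℝ} (h0 : 0 ≤ R) (hR : R ≤ Real.pi) :
    R ^ 2 ≤ area.real (geoBall y R) := by
  rw [area_real_geoBall y h0 hR]
  have h1 := Real.cos_le_one_sub_mul_cos_sq (x := R) (abs_le.2 ⟨by linarith [Real.pi_pos], hR⟩)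
  have h2 : 2 * Real.pi * (2 / Real.pi ^ 2 * R ^ 2) ≤ 2 * Real.pi * (1 - Real.cos R) := by
    gcongr
    linarith
  refine le_trans ?_ h2
  have h3 : 2 * Real.pi * (2 / Real.pi ^ 2 * R ^ 2) = 4 / Real.pi * R ^ 2 := by
    field_simp
    ring
  rw [h3]
  refine le_mul_of_one_le_left (sq_nonneg R) ?_
  rw [one_le_div Real.pi_pos]
  exact Real.pi_lt_four.le

end Caps

/-! ### The addition theorem for spherical harmonics -/

section AdditionTheorem

open MvPolynomial

theorem hasDerivAt_eval {σ : Type*} [Fintype σ] (p : MvPolynomial σ ℝ) {γ : ℝ → σ → ℝ}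
    {γ' : σ → ℝ} {t : ℝ} (hγ : ∀ i, HasDerivAt (fun t => γ t i) (γ' i) t) :
    HasDerivAt (fun t => eval (γ t) p) (∑ i, eval (γ t) (pderiv i p) * γ' i) t := by
  classical
  induction p using MvPolynomial.induction_on with
  | C a => simpa using hasDerivAt_const t a
  | add p q hp hq =>
    simp only [map_add, add_mul, Finset.sum_add_distrib]
    exact hp.add hq
  | mul_X p i hp =>
    have h := hp.mul (hγ i)
    simp only [eval_mul, eval_X]
    refine h.congr_deriv ?_
    simp [Derivation.leibniz, pderiv_X, Pi.single_apply, add_mul, Finset.sum_add_distrib,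
      Finset.sum_mul, apply_ite, ite_mul]
    rw [add_comm]
    congr 1
    refine Finset.sum_congr rfl fun j _ => by ring

theorem pderiv_pderiv_comm {σ : Type*} (i j : σ) (p : MvPolynomial σ ℝ) :
    pderiv i (pderiv j p) = pderiv j (pderiv i p) := by
  classical
  have h : ⁅(pderiv i : Derivation ℝ (MvPolynomial σ ℝ) (MvPolynomial σ ℝ)),
      (pderiv j : Derivation ℝ (MvPolynomial σ ℝ) (MvPolynomial σ ℝ))⁆ = 0 := by
    refine derivation_ext fun k => ?_
    rw [Derivation.commutator_apply, pderiv_X, pderiv_X, Pi.single_apply, Pi.single_apply]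
    split_ifs <;> simp
  have h' := DFunLike.congr_fun h p
  rw [Derivation.commutator_apply] at h'
  exact sub_eq_zero.1 h'

/-- Composition of a polynomial with the linear map of matrix `M`. -/
noncomputable def linSubst (M : Matrix (Fin 3) (Fin 3) ℝ) :
    MvPolynomial (Fin 3) ℝ →ₐ[ℝ] MvPolynomial (Fin 3) ℝ :=
  aeval fun i => ∑ j, C (M i j) * X j

theorem pderiv_linSubst (M : Matrix (Fin 3) (Fin 3) ℝ) (p : MvPolynomial (Fin 3) ℝ) (j : Fin 3) :
    pderiv j (linSubst M p) = ∑ i, C (M i j) * linSubst M (pderiv i p) := by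
  induction p using MvPolynomial.induction_on with
  | C a => simp [linSubst, MvPolynomial.algebraMap_eq]
  | add p q hp hq => simp only [map_add, hp, hq, mul_add, Finset.sum_add_distrib]
  | mul_X p i hp =>
    have hX : pderiv j (linSubst M (X i)) = C (M i j) := by
      simp [linSubst, pderiv_X, Pi.single_apply]
    have hX' : ∀ k, linSubst M (pderiv k (X i)) = if k = i then 1 else 0 := by
      intro k
      by_cases h : k = i
      · subst h; simp
      · simp [pderiv_X_of_ne (Ne.symm h), h]
    rw [map_mul, Derivation.leibniz, hX, hp]
    simp only [Derivation.leibniz, map_add, smul_eq_mul, map_mul, hX', mul_add,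
      Finset.sum_add_distrib, mul_ite, mul_one, mul_zero, Finset.sum_ite_eq', Finset.mem_univ,
      if_true, Finset.mul_sum]
    congr 1
    · ring
    · exact Finset.sum_congr rfl fun k _ => by ring

theorem polyLaplacian_apply (p : MvPolynomial (Fin 3) ℝ) :
    polyLaplacian p = ∑ i, pderiv i (pderiv i p) := by
  simp [polyLaplacian]

theorem polyLaplacian_linSubst {M : Matrix (Fin 3) (Fin 3) ℝ} (hM : M * M.transpose = 1)
    (p : MvPolynomial (Fin 3) ℝ) :
    polyLaplacian (linSubst M p) = linSubst M (polyLaplacian p) := by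
  have hM' : ∀ i k, ∑ j, C (M i j) * C (M k j) = (if i = k then 1 else 0 :
      MvPolynomial (Fin 3) ℝ) := by
    intro i k
    have h := congrFun (congrFun hM i) k
    rw [Matrix.mul_apply, Matrix.one_apply] at h
    simp only [Matrix.transpose_apply] at h
    simp only [← map_mul, ← map_sum, h]
    split_ifs <;> simp
  have h1 : ∀ j i, pderiv j (C (M i j) * linSubst M (pderiv i p))
      = ∑ k, C (M i j) * C (M k j) * linSubst M (pderiv k (pderiv i p)) := by
    intro j i
    rw [pderiv_C_mul, pderiv_linSubst, Finset.mul_sum]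
    exact Finset.sum_congr rfl fun k _ => (mul_assoc _ _ _).symm
  rw [polyLaplacian_apply, polyLaplacian_apply, map_sum]
  simp only [pderiv_linSubst M p, map_sum, h1]
  rw [Finset.sum_comm]
  refine Finset.sum_congr rfl fun i _ => ?_
  rw [Finset.sum_comm]
  simp only [← Finset.sum_mul, hM', ite_mul, one_mul, zero_mul, Finset.sum_ite_eq,
    Finset.mem_univ, if_true]

/-- The matrix of a linear isometry of space. -/
noncomputable def isometryMatrix
    (R : EuclideanSpace ℝ (Fin 3) ≃ₗᵢ[ℝ] EuclideanSpace ℝ (Fin 3)) : Matrix (Fin 3) (Fin 3) ℝ :=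
  Matrix.of fun i j => R (EuclideanSpace.single j 1) i

theorem isometry_apply (R : EuclideanSpace ℝ (Fin 3) ≃ₗᵢ[ℝ] EuclideanSpace ℝ (Fin 3))
    (x : EuclideanSpace ℝ (Fin 3)) (i : Fin 3) : R x i = ∑ j, isometryMatrix R i j * x j := by
  have h : x = ∑ j, x j • EuclideanSpace.single j (1 : ℝ) := by
    ext k
    simp [Pi.single_apply]
  conv_lhs => rw [h, map_sum]
  simp [isometryMatrix, mul_comm]

theorem isometryMatrix_mul_transpose
    (R : EuclideanSpace ℝ (Fin 3) ≃ₗᵢ[ℝ] EuclideanSpace ℝ (Fin 3)) :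
    isometryMatrix R * (isometryMatrix R).transpose = 1 := by
  rw [mul_eq_one_comm]
  ext i j
  have h := R.inner_map_map (EuclideanSpace.single j 1) (EuclideanSpace.single i 1)
  rw [EuclideanSpace.inner_single_right, PiLp.inner_apply] at h
  rw [Matrix.mul_apply, Matrix.one_apply]
  simpa [isometryMatrix, Pi.single_apply] using h

theorem comp_sphereMap_mem_sphericalHarmonics {m : ℕ} {h : S2 → ℝ}
    (hh : h ∈ sphericalHarmonics m)
    (R : EuclideanSpace ℝ (Fin 3) ≃ₗᵢ[ℝ] EuclideanSpace ℝ (Fin 3)) :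
    h ∘ sphereMap R ∈ sphericalHarmonics m := by
  obtain ⟨p, ⟨hp1, hp2⟩, rfl⟩ := hh
  refine ⟨linSubst (isometryMatrix R) p, ⟨?_, ?_⟩, ?_⟩
  · have h1 : p.IsHomogeneous m := hp1
    have h2 := h1.aeval (S := ℝ) (n := 1) (fun i => ∑ j, C (isometryMatrix R i j) * X j)
      fun i => IsHomogeneous.sum _ _ _ fun j _ => by
        simpa using (isHomogeneous_C (Fin 3) (isometryMatrix R i j)).mul (isHomogeneous_X ℝ j)
    rw [one_mul] at h2
    exact h2
  · change polyLaplacian _ = 0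
    rw [polyLaplacian_linSubst (isometryMatrix_mul_transpose R), (hp2 : polyLaplacian p = 0),
      map_zero]
  · funext x
    change eval _ (linSubst (isometryMatrix R) p) = eval _ p
    rw [linSubst, aeval_def, ← MvPolynomial.coe_eval₂Hom, ← RingHom.comp_apply]
    have : ((eval fun i => (x : EuclideanSpace ℝ (Fin 3)) i).comp
        (eval₂Hom (algebraMap ℝ (MvPolynomial (Fin 3) ℝ))
          fun i => ∑ j, C (isometryMatrix R i j) * X j))
        = eval fun i => (sphereMap R x : EuclideanSpace ℝ (Fin 3)) i := by
      refine MvPolynomial.ringHom_ext (fun a => ?_) fun i => ?_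
      · simp [MvPolynomial.algebraMap_eq]
      · simp [isometry_apply R x i]
    rw [this]

theorem continuous_of_mem_sphericalHarmonics {m : ℕ} {h : S2 → ℝ}
    (hh : h ∈ sphericalHarmonics m) : Continuous h := by
  obtain ⟨p, -, rfl⟩ := hh
  change Continuous fun x : S2 => eval (fun i => (x : EuclideanSpace ℝ (Fin 3)) i) p
  exact (MvPolynomial.continuous_eval p).comp (by fun_prop)

/-- The sum `∑ φ_j(x) φ_j(y)`, for orthonormal `φ` the reproducing kernel of their span. -/
def sphereKernel {ι : Type*} [Fintype ι] (φ : ι → S2 → ℝ) (x y : S2) : ℝ := ∑ j, φ j x * φ j y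

variable {m : ℕ} {φ : Fin (2 * m + 1) → S2 → ℝ}

theorem IsHarmonicONB.mem (hφ : IsHarmonicONB m φ) (j : Fin (2 * m + 1)) :
    φ j ∈ sphericalHarmonics m := by
  rw [← hφ.span_eq]
  exact Submodule.subset_span ⟨j, rfl⟩

theorem IsHarmonicONB.continuous (hφ : IsHarmonicONB m φ) (j : Fin (2 * m + 1)) :
    Continuous (φ j) := continuous_of_mem_sphericalHarmonics (hφ.mem j)

theorem integrable_of_continuous {f : S2 → ℝ} (hf : Continuous f) : Integrable f area :=
  hf.integrable_of_hasCompactSupport (HasCompactSupport.of_compactSpace f)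

/-- An isometry acts on the spherical harmonics by an orthogonal matrix, so it preserves the
reproducing kernel. -/
theorem IsHarmonicONB.sphereKernel_sphereMap (hφ : IsHarmonicONB m φ)
    (R : EuclideanSpace ℝ (Fin 3) ≃ₗᵢ[ℝ] EuclideanSpace ℝ (Fin 3)) (x y : S2) :
    sphereKernel φ (sphereMap R x) (sphereMap R y) = sphereKernel φ x y := by
  have hM : ∀ i, ∃ c : Fin (2 * m + 1) → ℝ, ∑ j, c j • φ j = φ i ∘ sphereMap R := by
    intro i
    rw [← Submodule.mem_span_range_iff_exists_fun, hφ.span_eq]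
    exact comp_sphereMap_mem_sphericalHarmonics (hφ.mem i) R
  choose M hM using hM
  have hM' : ∀ i x, φ i (sphereMap R x) = ∑ j, M i j * φ j x := by
    intro i x
    have := congrFun (hM i) x
    simp only [Finset.sum_apply, Pi.smul_apply, smul_eq_mul, Function.comp] at this
    exact this.symm
  have horth : Matrix.of M * (Matrix.of M).transpose = 1 := by
    ext i k
    rw [Matrix.mul_apply, Matrix.one_apply, ← hφ.orthonormal i k]
    have hcomp : ∫ x, φ i x * φ k x ∂area
        = ∫ x, φ i (sphereMap R x) * φ k (sphereMap R x) ∂area := by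
      have hc : Continuous fun x => φ i x * φ k x := (hφ.continuous i).mul (hφ.continuous k)
      conv_lhs => rw [← (measurePreserving_sphereMap R).map_eq]
      exact integral_map (continuous_sphereMap R).measurable.aemeasurable
        hc.aestronglyMeasurable
    rw [hcomp]
    simp only [hM', Finset.sum_mul_sum]
    rw [integral_finsetSum _ fun j _ => integrable_finsetSum _ fun l _ =>
      integrable_of_continuous (by have := hφ.continuous; fun_prop)]
    refine Finset.sum_congr rfl fun j _ => ?_
    rw [integral_finsetSum _ fun l _ =>
      integrable_of_continuous (by have := hφ.continuous; fun_prop)]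
    have e : ∀ l, ∫ x, M i j * φ j x * (M k l * φ l x) ∂area
        = M i j * M k l * if j = l then 1 else 0 := by
      intro l
      rw [← hφ.orthonormal j l, ← integral_const_mul]
      exact integral_congr_ae (Filter.Eventually.of_forall fun x => by ring)
    simp [e]
  rw [mul_eq_one_comm] at horth
  have horth' : ∀ j l, ∑ i, M i j * M i l = if j = l then 1 else 0 := by
    intro j l
    have := congrFun (congrFun horth j) l
    rwa [Matrix.mul_apply, Matrix.one_apply] at this
  simp only [sphereKernel, hM', Finset.sum_mul_sum]
  rw [Finset.sum_comm]
  refine Finset.sum_congr rfl fun j _ => ?_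
  rw [Finset.sum_comm]
  have e : ∀ l, ∑ i, M i j * φ j x * (M i l * φ l y)
      = (∑ i, M i j * M i l) * (φ j x * φ l y) := by
    intro l
    rw [Finset.sum_mul]
    exact Finset.sum_congr rfl fun i _ => by ring
  simp [e, horth']

/-- The restriction of a polynomial to the great circle in the plane of the first two axes is
`A (t) + s B (t)` with `t`, `s` the coordinates. -/
theorem exists_eval_circle_eq (p : MvPolynomial (Fin 3) ℝ) :
    ∃ A B : Polynomial ℝ, ∀ t s : ℝ, t ^ 2 + s ^ 2 = 1 →
      eval ![t, s, 0] p = A.eval t + s * B.eval t := by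
  induction p using MvPolynomial.induction_on with
  | C a => exact ⟨Polynomial.C a, 0, fun t s _ => by simp⟩
  | add p q hp hq =>
    obtain ⟨A, B, h⟩ := hp
    obtain ⟨A', B', h'⟩ := hq
    refine ⟨A + A', B + B', fun t s hts => ?_⟩
    rw [map_add, h t s hts, h' t s hts, Polynomial.eval_add, Polynomial.eval_add]
    ring
  | mul_X p i hp =>
    obtain ⟨A, B, h⟩ := hp
    fin_cases i
    · refine ⟨A * Polynomial.X, B * Polynomial.X, fun t s hts => ?_⟩
      simp [h t s hts]
      ring
    · refine ⟨B * (1 - Polynomial.X ^ 2), A, fun t s hts => ?_⟩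
      simp [h t s hts]
      linear_combination B.eval t * hts
    · exact ⟨0, 0, fun t s hts => by simp⟩

/-- A harmonic homogeneous polynomial that on the sphere depends on the first coordinate only is
there a solution of Legendre's equation in that coordinate: the equation is Laplace's, with the
radial derivatives eliminated by Euler's identity and those along the circle of latitude by
symmetry. -/
theorem exists_isLegendreSolution {p : MvPolynomial (Fin 3) ℝ} (hp : p.IsHomogeneous m)
    (hL : polyLaplacian p = 0)
    (hz : ∀ v w : Fin 3 → ℝ, v 0 ^ 2 + v 1 ^ 2 + v 2 ^ 2 = 1 → w 0 ^ 2 + w 1 ^ 2 + w 2 ^ 2 = 1 →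
      v 0 = w 0 → eval v p = eval w p) :
    ∃ A : Polynomial ℝ, IsLegendreSolution m A ∧
      ∀ v : Fin 3 → ℝ, v 0 ^ 2 + v 1 ^ 2 + v 2 ^ 2 = 1 → eval v p = A.eval (v 0) := by
  obtain ⟨A, B, hAB⟩ := exists_eval_circle_eq p
  have hA : ∀ t s : ℝ, t ^ 2 + s ^ 2 = 1 → eval ![t, s, 0] p = A.eval t := by
    intro t s hts
    have h1 := hAB t s hts
    have h2 := hAB t (-s) (by linarith [neg_sq s])
    have h3 := hz ![t, s, 0] ![t, -s, 0] (by simpa using hts) (by simpa using hts) rfl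
    linarith
  refine ⟨A, ?_, fun v hv => ?_⟩
  · -- Euler's identity and its first derivatives
    have hE : ∀ v, ∑ i, v i * eval v (pderiv i p) = m * eval v p := by
      intro v
      have h := congrArg (eval v) hp.sum_X_mul_pderiv
      simpa using h
    have hE' : ∀ v k, eval v (pderiv k p) + ∑ i, v i * eval v (pderiv k (pderiv i p))
        = m * eval v (pderiv k p) := by
      intro v k
      have h := congrArg (fun q => eval v (pderiv k q)) hp.sum_X_mul_pderiv
      simp only [map_sum, Derivation.leibniz, smul_eq_mul, pderiv_X, map_add, eval_mul, eval_X,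
        Finset.sum_add_distrib, Pi.single_apply, mul_ite, mul_one, mul_zero, add_zero,
        Finset.sum_ite_eq', Finset.mem_univ, if_true, nsmul_eq_mul, map_natCast,
        Derivation.map_natCast] at h
      linarith
    have hL' : ∀ v, ∑ i, eval v (pderiv i (pderiv i p)) = 0 := by
      intro v
      rw [polyLaplacian_apply] at hL
      rw [← map_sum, hL, map_zero]
    have hcomm : pderiv 0 (pderiv 1 p) = pderiv 1 (pderiv 0 p) := pderiv_pderiv_comm _ _ _
    have hγ : ∀ θ i, HasDerivAt (fun θ => (![Real.cos θ, Real.sin θ, 0] : Fin 3 → ℝ) i)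
        ((![-Real.sin θ, Real.cos θ, 0] : Fin 3 → ℝ) i) θ := by
      intro θ i
      fin_cases i
      · exact Real.hasDerivAt_cos θ
      · exact Real.hasDerivAt_sin θ
      · exact hasDerivAt_const θ 0
    have hAd : ∀ (Q : Polynomial ℝ) θ, HasDerivAt (fun θ => Q.eval (Real.cos θ))
        (Q.derivative.eval (Real.cos θ) * -Real.sin θ) θ :=
      fun Q θ => (Q.hasDerivAt (Real.cos θ)).comp θ (Real.hasDerivAt_cos θ)
    -- first derivative along the meridian
    have hG1 : ∀ θ, eval ![Real.cos θ, Real.sin θ, 0] (pderiv 0 p) * -Real.sin θ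
        + eval ![Real.cos θ, Real.sin θ, 0] (pderiv 1 p) * Real.cos θ
        = A.derivative.eval (Real.cos θ) * -Real.sin θ := by
      intro θ
      have h1 := hasDerivAt_eval p (hγ θ)
      simp only [hA _ _ (Real.cos_sq_add_sin_sq _)] at h1
      have h2 := h1.unique (hAd A θ)
      simpa [Fin.sum_univ_three] using h2
    -- second derivative along the meridian
    have hG2 : ∀ θ, _ := fun θ =>
      HasDerivAt.unique ((((hasDerivAt_eval (pderiv 0 p) (hγ θ)).mul
          (Real.hasDerivAt_sin θ).neg).add
        ((hasDerivAt_eval (pderiv 1 p) (hγ θ)).mul (Real.hasDerivAt_cos θ))))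
        (((hAd A.derivative θ).mul (Real.hasDerivAt_sin θ).neg).congr_of_eventuallyEq
          (Filter.Eventually.of_forall fun θ => hG1 θ))
    -- second derivative along the circle of latitude
    have hβ : ∀ θ, Real.sin θ * eval ![Real.cos θ, Real.sin θ, 0] (pderiv 1 p)
        = Real.sin θ ^ 2 * eval ![Real.cos θ, Real.sin θ, 0] (pderiv 2 (pderiv 2 p)) := by
      intro θ
      set c := Real.cos θ
      set s := Real.sin θ
      have hcs : c ^ 2 + s ^ 2 = 1 := Real.cos_sq_add_sin_sq θ
      have hd : ∀ α i, HasDerivAt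
          (fun α => (![c, s * Real.cos α, s * Real.sin α] : Fin 3 → ℝ) i)
          ((![0, s * -Real.sin α, s * Real.cos α] : Fin 3 → ℝ) i) α := by
        intro α i
        fin_cases i
        · exact hasDerivAt_const α c
        · exact (Real.hasDerivAt_cos α).const_mul s
        · exact (Real.hasDerivAt_sin α).const_mul s
      have hconst : ∀ α, eval ![c, s * Real.cos α, s * Real.sin α] p = A.eval c := by
        intro α
        rw [← hA c s hcs]
        refine hz _ _ ?_ (by simpa using hcs) rfl
        simp
        linear_combination hcs + s ^ 2 * Real.cos_sq_add_sin_sq α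
      have h1 : ∀ α, eval ![c, s * Real.cos α, s * Real.sin α] (pderiv 1 p) * (s * -Real.sin α)
          + eval ![c, s * Real.cos α, s * Real.sin α] (pderiv 2 p) * (s * Real.cos α) = 0 := by
        intro α
        have h1 := hasDerivAt_eval p (hd α)
        simp only [hconst] at h1
        have h2 := h1.unique (hasDerivAt_const α _)
        simpa [Fin.sum_univ_three] using h2
      have h2 := HasDerivAt.unique ((((hasDerivAt_eval (pderiv 1 p) (hd 0)).mul
          ((Real.hasDerivAt_sin 0).neg.const_mul s)).add
        ((hasDerivAt_eval (pderiv 2 p) (hd 0)).mul ((Real.hasDerivAt_cos 0).const_mul s))))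
        ((hasDerivAt_const (0 : ℝ) (0 : ℝ)).congr_of_eventuallyEq
          (Filter.Eventually.of_forall fun α => h1 α))
      simp [Fin.sum_univ_three] at h2
      linear_combination -h2
    refine Polynomial.eq_of_infinite_eval_eq _ _
      (Set.Infinite.mono (s := Set.Ioo (-1) 1) ?_ (Set.Ioo_infinite (by norm_num)))
    intro t ht
    set θ := Real.arccos t with hθ
    have hc : Real.cos θ = t := Real.cos_arccos ht.1.le ht.2.le
    have hs : 0 < Real.sin θ := by
      rw [hθ, Real.sin_arccos, Real.sqrt_pos]
      nlinarith [ht.1, ht.2]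
    have g2 := hG2 θ
    have g1 := hG1 θ
    have b := hβ θ
    have e := hE ![Real.cos θ, Real.sin θ, 0]
    have e0 := hE' ![Real.cos θ, Real.sin θ, 0] 0
    have e1 := hE' ![Real.cos θ, Real.sin θ, 0] 1
    have l := hL' ![Real.cos θ, Real.sin θ, 0]
    have a := hA _ _ (Real.cos_sq_add_sin_sq θ)
    have pyth := Real.cos_sq_add_sin_sq θ
    simp [Fin.sum_univ_three, hcomm] at g2 g1 b e e0 e1 l
    change Polynomial.eval t _ = Polynomial.eval t 0
    rw [← hc]
    simp only [Polynomial.eval_add, Polynomial.eval_sub, Polynomial.eval_mul, Polynomial.eval_pow,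
      Polynomial.eval_X, Polynomial.eval_one, Polynomial.eval_ofNat, Polynomial.eval_natCast,
      Polynomial.eval_zero, ← a]
    generalize eval ![Real.cos θ, Real.sin θ, 0] (pderiv 0 p) = p0 at *
    generalize eval ![Real.cos θ, Real.sin θ, 0] (pderiv 1 p) = p1 at *
    generalize eval ![Real.cos θ, Real.sin θ, 0] (pderiv 0 (pderiv 0 p)) = p00 at *
    generalize eval ![Real.cos θ, Real.sin θ, 0] (pderiv 1 (pderiv 0 p)) = p01 at *
    generalize eval ![Real.cos θ, Real.sin θ, 0] (pderiv 1 (pderiv 1 p)) = p11 at *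
    generalize eval ![Real.cos θ, Real.sin θ, 0] (pderiv 2 (pderiv 2 p)) = p22 at *
    have b' : p1 = Real.sin θ * p22 := by
      refine mul_left_cancel₀ hs.ne' ?_
      linear_combination b
    refine mul_left_cancel₀ hs.ne' ?_
    linear_combination (-Real.sin θ) * g2 - Real.cos θ * g1 + Real.sin θ * l
      - Real.sin θ * Real.cos θ * e0 - Real.sin θ ^ 2 * e1 - (Real.sin θ * m + Real.sin θ) * e
      + b' + (Real.sin θ * (p00 + p11) + p1
        - Real.sin θ * Polynomial.eval (Real.cos θ) (A.derivative.derivative)) * pyth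
  · have h0 : 0 ≤ 1 - v 0 ^ 2 := by nlinarith [sq_nonneg (v 1), sq_nonneg (v 2)]
    have hs : v 0 ^ 2 + √(1 - v 0 ^ 2) ^ 2 = 1 := by
      rw [Real.sq_sqrt h0]
      ring
    rw [← hA (v 0) _ hs]
    exact hz _ _ hv (by simpa using hs) rfl

/-- The first vector of the standard basis, as a point of the sphere. -/
noncomputable def spherePole : S2 := ⟨EuclideanSpace.single 0 1, by simp⟩

theorem inner_spherePole (x : S2) :
    inner ℝ (x : EuclideanSpace ℝ (Fin 3)) spherePole = (x : EuclideanSpace ℝ (Fin 3)) 0 := by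
  simp [spherePole, EuclideanSpace.inner_single_right]

theorem IsHarmonicONB.sphereKernel_eq_of_inner_eq (hφ : IsHarmonicONB m φ) {x y x' y' : S2}
    (h : inner ℝ (x : EuclideanSpace ℝ (Fin 3)) y
      = inner ℝ (x' : EuclideanSpace ℝ (Fin 3)) y') :
    sphereKernel φ x y = sphereKernel φ x' y' := by
  obtain ⟨R, rfl, rfl⟩ := exists_sphereMap_eq h
  exact (hφ.sphereKernel_sphereMap R x y).symm

theorem sum_sq_coe_sphere (x : S2) : (x : EuclideanSpace ℝ (Fin 3)) 0 ^ 2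
    + (x : EuclideanSpace ℝ (Fin 3)) 1 ^ 2 + (x : EuclideanSpace ℝ (Fin 3)) 2 ^ 2 = 1 := by
  have h := EuclideanSpace.norm_sq_eq (x : EuclideanSpace ℝ (Fin 3))
  rw [Fin.sum_univ_three] at h
  simpa using h.symm

theorem exists_coe_sphere {v : Fin 3 → ℝ} (hv : v 0 ^ 2 + v 1 ^ 2 + v 2 ^ 2 = 1) :
    ∃ x : S2, (fun i => (x : EuclideanSpace ℝ (Fin 3)) i) = v := by
  refine ⟨⟨WithLp.toLp 2 v, ?_⟩, rfl⟩
  rw [mem_sphere_zero_iff_norm, EuclideanSpace.norm_eq, Fin.sum_univ_three]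
  simp [hv]

theorem area_real_univ_pos : 0 < area.real Set.univ := by
  rw [area, Measure.toSphere_real_apply_univ]
  have : 0 < (volume : Measure (EuclideanSpace ℝ (Fin 3))).real (Metric.ball 0 1) :=
    ENNReal.toReal_pos (Metric.measure_ball_pos _ _ one_pos).ne' measure_ball_lt_top.ne
  rw [finrank_euclideanSpace_fin]
  positivity

/-- The addition theorem for spherical harmonics. The constant is found by integrating the kernel
over the diagonal. -/
theorem IsHarmonicONB.sphereKernel_eq (hφ : IsHarmonicONB m φ) (x y : S2) :
    sphereKernel φ x y = (2 * m + 1) / area.real Set.univ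
      * (legendre m).eval (inner ℝ (x : EuclideanSpace ℝ (Fin 3)) y) := by
  -- up to the constant, the formula is that for the zonal function about the pole
  have hzonal : ∀ x y, sphereKernel φ x y = sphereKernel φ spherePole spherePole
      * (legendre m).eval (inner ℝ (x : EuclideanSpace ℝ (Fin 3)) y) := by
    intro x y
    have hmem : (fun x => sphereKernel φ x spherePole) ∈ sphericalHarmonics m := by
      have : (fun x => sphereKernel φ x spherePole) = ∑ j, φ j spherePole • φ j := by
        funext x
        simp [sphereKernel, mul_comm]
      rw [this]
      exact Submodule.sum_mem _ fun j _ => Submodule.smul_mem _ _ (hφ.mem j)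
    obtain ⟨p, ⟨hp, hL⟩, hpx⟩ := hmem
    have hpx' : ∀ x : S2, eval (fun i => (x : EuclideanSpace ℝ (Fin 3)) i) p
      = sphereKernel φ x spherePole := congrFun hpx
    obtain ⟨A, hA, hAx⟩ := exists_isLegendreSolution (m := m) hp hL (by
      intro v w hv hw hvw
      obtain ⟨a, rfl⟩ := exists_coe_sphere hv
      obtain ⟨b, rfl⟩ := exists_coe_sphere hw
      rw [hpx', hpx']
      exact hφ.sphereKernel_eq_of_inner_eq (by rw [inner_spherePole, inner_spherePole]; exact hvw))
    have hAk : ∀ x : S2, sphereKernel φ x spherePole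
        = A.eval ((x : EuclideanSpace ℝ (Fin 3)) 0) := fun x => by
      rw [← hpx', hAx _ (sum_sq_coe_sphere x)]
    obtain ⟨R, hR, -⟩ := exists_sphereMap_eq (x := y) (y := y) (x' := spherePole)
      (y' := spherePole) (by simp)
    have h1 : inner ℝ (x : EuclideanSpace ℝ (Fin 3)) y
        = inner ℝ (sphereMap R x : EuclideanSpace ℝ (Fin 3)) spherePole := by
      rw [← hR]
      exact (R.inner_map_map _ _).symm
    have h2 : sphereKernel φ spherePole spherePole = A.eval 1 := by
      rw [hAk]
      simp [spherePole]
    rw [hφ.sphereKernel_eq_of_inner_eq h1, h1, hAk, inner_spherePole, h2,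
      hA.eq_C_mul_legendre]
    simp [legendre_eval_one]
  have hdiag : ∀ x, sphereKernel φ x x = sphereKernel φ spherePole spherePole := by
    intro x
    rw [hzonal x x]
    simp [legendre_eval_one]
  have htrace : ∫ x, sphereKernel φ x x ∂area = 2 * m + 1 := by
    simp only [sphereKernel]
    rw [integral_finsetSum _ fun j _ =>
      integrable_of_continuous (by have := hφ.continuous; fun_prop)]
    simp [hφ.orthonormal]
  simp only [hdiag, integral_const, smul_eq_mul] at htrace
  rw [hzonal x y, ← htrace, mul_div_cancel_left₀ _ area_real_univ_pos.ne']

end AdditionTheorem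

/-! ### Gaussian quadratic forms -/

section Gaussian

/-- The moments of order at most four of a centred Gaussian variable. -/
theorem integral_pow_gaussianReal (v : ℝ≥0) :
    (∫ x, x ^ 1 ∂gaussianReal 0 v = 0) ∧ (∫ x, x ^ 2 ∂gaussianReal 0 v = v) ∧
      (∫ x, x ^ 3 ∂gaussianReal 0 v = 0) ∧ (∫ x, x ^ 4 ∂gaussianReal 0 v = 3 * (v : ℝ) ^ 2) := by
  have hm : ∀ n, ∫ x, x ^ n ∂gaussianReal 0 v
      = iteratedDeriv n (fun t => Real.exp ((v : ℝ) * t ^ 2 / 2)) 0 := by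
    intro n
    have h := iteratedDeriv_mgf_zero (X := id) (μ := gaussianReal 0 v)
      (by rw [integrableExpSet_id_gaussianReal]; simp) n
    rw [mgf_id_gaussianReal] at h
    simp only [zero_mul, zero_add] at h
    rw [h]
    rfl
  have h0 : ∀ t : ℝ, HasDerivAt (fun t => Real.exp ((v : ℝ) * t ^ 2 / 2))
      ((v : ℝ) * t * Real.exp ((v : ℝ) * t ^ 2 / 2)) t := by
    intro t
    have := (((hasDerivAt_pow 2 t).const_mul (v : ℝ)).div_const 2).exp
    refine this.congr_deriv ?_
    simp
    ring
  have hd : ∀ (p p' : ℝ → ℝ), (∀ t, HasDerivAt p (p' t) t) →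
      deriv (fun t => p t * Real.exp ((v : ℝ) * t ^ 2 / 2))
        = fun t => (p' t + p t * (v * t)) * Real.exp ((v : ℝ) * t ^ 2 / 2) := by
    intro p p' hp
    funext t
    refine ((hp t).mul (h0 t)).deriv.trans ?_
    ring
  have e1 : deriv (fun t => Real.exp ((v : ℝ) * t ^ 2 / 2))
      = fun t => ((v : ℝ) * t) * Real.exp ((v : ℝ) * t ^ 2 / 2) := by
    funext t
    exact (h0 t).deriv
  have e2 := hd (fun t => (v : ℝ) * t) (fun t => v)
    (fun t => by simpa using (hasDerivAt_id t).const_mul (v : ℝ))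
  have e3 := hd (fun t => (v : ℝ) + v * t * (v * t)) (fun t => 2 * (v : ℝ) ^ 2 * t) (fun t => by
    have h := (hasDerivAt_id t).const_mul (v : ℝ)
    refine ((h.mul h).const_add (v : ℝ)).congr_deriv ?_
    simp
    ring)
  have e4 := hd (fun t => 2 * (v : ℝ) ^ 2 * t + (v + v * t * (v * t)) * (v * t))
    (fun t => 2 * (v : ℝ) ^ 2 + (2 * (v : ℝ) ^ 2 * t * (v * t)
      + (v + v * t * (v * t)) * v)) (fun t => by
    have h := (hasDerivAt_id t).const_mul (v : ℝ)
    refine (((hasDerivAt_id t).const_mul (2 * (v : ℝ) ^ 2)).add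
      (((h.mul h).const_add (v : ℝ)).mul h)).congr_deriv ?_
    simp only [id, Pi.mul_apply]
    ring)
  refine ⟨?_, ?_, ?_, ?_⟩ <;> rw [hm] <;>
    simp only [iteratedDeriv_succ', iteratedDeriv_zero, e1, e2, e3, e4] <;> simp
  ring

variable {Ω ι : Type*} [MeasurableSpace Ω] {P : Measure Ω}
  {c : ι → Ω → ℝ} {v : ℝ≥0}

/-- Products of powers of independent centred Gaussian variables of variance `v`. -/
theorem integral_prod_pow_of_gaussian [Fintype ι] (hc : ∀ j, HasLaw (c j) (gaussianReal 0 v) P)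
    (hi : iIndepFun c P) (n : ι → ℕ) :
    ∫ ω, ∏ a, c a ω ^ n a ∂P = ∏ a, ∫ x, x ^ n a ∂gaussianReal 0 v := by
  rw [hi.integral_fun_prod_comp (f := fun a x => x ^ n a) (fun i => (hc i).aemeasurable)
    (fun i => by fun_prop)]
  refine Finset.prod_congr rfl fun a _ => ?_
  exact (hc a).integral_comp (f := fun x => x ^ n a) (by fun_prop)

theorem integral_mul_of_gaussian [Fintype ι] [DecidableEq ι]
    (hc : ∀ j, HasLaw (c j) (gaussianReal 0 v) P)
    (hi : iIndepFun c P) (i j : ι) :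
    ∫ ω, c i ω * c j ω ∂P = if i = j then (v : ℝ) else 0 := by
  have hP := hi.isProbabilityMeasure
  obtain ⟨m1, m2, -, -⟩ := integral_pow_gaussianReal v
  have h := integral_prod_pow_of_gaussian hc hi
    (fun a => (if i = a then 1 else 0) + if j = a then 1 else 0)
  simp only [pow_add, Finset.prod_mul_distrib, Finset.prod_pow_boole, Finset.mem_univ,
    if_true] at h
  rw [h]
  split_ifs with hij
  · subst hij
    rw [Finset.prod_eq_single i]
    · simpa [← sq] using m2
    · intro b _ hb
      simp [Ne.symm hb]
    · simp
  · refine Finset.prod_eq_zero (Finset.mem_univ i) ?_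
    simp [Ne.symm hij]

/-- Wick's formula for four factors. -/
theorem integral_mul_mul_mul_of_gaussian [Fintype ι] [DecidableEq ι]
    (hc : ∀ j, HasLaw (c j) (gaussianReal 0 v) P)
    (hi : iIndepFun c P) (i j k l : ι) :
    ∫ ω, c i ω * c j ω * (c k ω * c l ω) ∂P
      = (v : ℝ) ^ 2 * ((if i = j ∧ k = l then 1 else 0) + (if i = k ∧ j = l then 1 else 0)
        + if i = l ∧ j = k then 1 else 0) := by
  have hP := hi.isProbabilityMeasure
  obtain ⟨m1, m2, m3, m4⟩ := integral_pow_gaussianReal v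
  have h : ∀ i j k l, ∫ ω, c i ω * c j ω * (c k ω * c l ω) ∂P = _ := fun i j k l =>
    (by simp only [pow_add, Finset.prod_mul_distrib, Finset.prod_pow_boole, Finset.mem_univ,
        if_true] :
      ∫ ω, c i ω * c j ω * (c k ω * c l ω) ∂P = ∫ ω, ∏ a, c a ω ^ (((if i = a then 1 else 0)
        + if j = a then 1 else 0) + ((if k = a then 1 else 0) + if l = a then 1 else 0)) ∂P).trans
    (integral_prod_pow_of_gaussian hc hi _)
  have single : ∀ i j k l, i ≠ j → i ≠ k → i ≠ l →
      ∫ ω, c i ω * c j ω * (c k ω * c l ω) ∂P = 0 := by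
    intro i j k l h1 h2 h3
    rw [h]
    refine Finset.prod_eq_zero (Finset.mem_univ i) ?_
    simp [h1.symm, h2.symm, h3.symm]
  have pairs : ∀ i k, i ≠ k → ∫ ω, c i ω * c i ω * (c k ω * c k ω) ∂P = (v : ℝ) ^ 2 := by
    intro i k hik
    rw [h, ← Finset.mul_prod_erase _ _ (Finset.mem_univ i),
      ← Finset.mul_prod_erase _ _ (Finset.mem_erase.2 ⟨hik.symm, Finset.mem_univ k⟩),
      Finset.prod_eq_one]
    · have e1 : ((if i = i then 1 else 0) + if i = i then 1 else 0)
        + ((if k = i then 1 else 0) + if k = i then 1 else 0) = 2 := by simp [hik.symm]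
      have e2 : ((if i = k then 1 else 0) + if i = k then 1 else 0)
        + ((if k = k then 1 else 0) + if k = k then 1 else 0) = 2 := by simp [hik]
      rw [e1, e2, m2]
      ring
    · intro b hb
      simp only [Finset.mem_erase] at hb
      simp [Ne.symm hb.1, Ne.symm hb.2.1]
  have four : ∀ i, ∫ ω, c i ω * c i ω * (c i ω * c i ω) ∂P = 3 * (v : ℝ) ^ 2 := by
    intro i
    rw [h, Finset.prod_eq_single i]
    · simpa using m4
    · intro b _ hb
      simp [Ne.symm hb]
    · simp
  -- the case of a repeated first pair; the others follow by permuting the factors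
  have main : ∀ i k l, ∫ ω, c i ω * c i ω * (c k ω * c l ω) ∂P
      = (v : ℝ) ^ 2 * ((if k = l then 1 else 0) + (if i = k ∧ i = l then 1 else 0)
        + if i = l ∧ i = k then 1 else 0) := by
    intro i k l
    by_cases hkl : k = l
    · subst hkl
      by_cases hik : i = k
      · subst hik
        rw [four]
        simp
        ring
      · rw [pairs i k hik]
        simp [hik]
    · by_cases hik : i = k
      · subst hik
        have := single l i i i (Ne.symm hkl) (Ne.symm hkl) (Ne.symm hkl)
        rw [show (fun ω => c i ω * c i ω * (c i ω * c l ω))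
          = fun ω => c l ω * c i ω * (c i ω * c i ω) by funext ω; ring, this]
        simp [hkl]
      · have := single k l i i hkl (Ne.symm hik) (Ne.symm hik)
        rw [show (fun ω => c i ω * c i ω * (c k ω * c l ω))
          = fun ω => c k ω * c l ω * (c i ω * c i ω) by funext ω; ring, this]
        simp [hkl, hik]
  by_cases hij : i = j
  · subst hij
    rw [main]
    simp
  by_cases hik : i = k
  · subst hik
    rw [show (fun ω => c i ω * c j ω * (c i ω * c l ω))
      = fun ω => c i ω * c i ω * (c j ω * c l ω) by funext ω; ring, main]
    simp [hij, Ne.symm hij]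
  by_cases hil : i = l
  · subst hil
    rw [show (fun ω => c i ω * c j ω * (c k ω * c i ω))
      = fun ω => c i ω * c i ω * (c j ω * c k ω) by funext ω; ring, main]
    simp [hij, hik]
  rw [single i j k l hij hik hil]
  simp [hij, hik, hil]

theorem memLp_mul_of_gaussian (hc : ∀ j, HasLaw (c j) (gaussianReal 0 v) P) (i j : ι) :
    MemLp (fun ω => c i ω * c j ω) 2 P := by
  have h4 : ∀ i, MemLp (c i) 4 P := by
    intro i
    have := memLp_id_gaussianReal' (μ := 0) (v := v) 4 (by simp)
    rw [← (hc i).map_eq, memLp_map_measure_iff (by fun_prop) (hc i).aemeasurable] at this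
    exact this
  have : ENNReal.HolderTriple 4 4 2 := ⟨by
    rw [← two_mul, show (4 : ENNReal) = 2 * 2 by norm_num,
      ENNReal.mul_inv (by simp) (by simp), ← mul_assoc, ENNReal.mul_inv_cancel (by simp) (by simp),
      one_mul]⟩
  exact (h4 j).mul (h4 i)

theorem memLp_quadratic_of_gaussian [Fintype ι] (hc : ∀ j, HasLaw (c j) (gaussianReal 0 v) P)
    (A : ι → ι → ℝ) : MemLp (fun ω => ∑ j, ∑ k, A j k * (c j ω * c k ω)) 2 P :=
  memLp_finsetSum _ fun j _ => memLp_finsetSum _ fun k _ =>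
    (memLp_mul_of_gaussian hc j k).const_mul _

/-- The variance of a quadratic form in independent centred Gaussian variables. -/
theorem variance_quadratic_of_gaussian [Fintype ι] [DecidableEq ι]
    (hc : ∀ j, HasLaw (c j) (gaussianReal 0 v) P)
    (hi : iIndepFun c P) (A : ι → ι → ℝ) (hA : ∀ j k, A j k = A k j) :
    variance (fun ω => ∑ j, ∑ k, A j k * (c j ω * c k ω)) P
      = 2 * (v : ℝ) ^ 2 * ∑ j, ∑ k, A j k ^ 2 := by
  have hP := hi.isProbabilityMeasure
  have hZ : ∀ p : ι × ι, MemLp (fun ω => A p.1 p.2 * (c p.1 ω * c p.2 ω)) 2 P :=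
    fun p => (memLp_mul_of_gaussian hc _ _).const_mul _
  have hcov : ∀ p q : ι × ι, cov[fun ω => A p.1 p.2 * (c p.1 ω * c p.2 ω),
      fun ω => A q.1 q.2 * (c q.1 ω * c q.2 ω); P]
      = A p.1 p.2 * (A q.1 q.2 * ((v : ℝ) ^ 2 * ((if p.1 = q.1 ∧ p.2 = q.2 then 1 else 0)
        + if p.1 = q.2 ∧ p.2 = q.1 then 1 else 0))) := by
    intro p q
    rw [covariance_const_mul_left, covariance_const_mul_right,
      covariance_eq_sub (memLp_mul_of_gaussian hc _ _) (memLp_mul_of_gaussian hc _ _)]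
    simp only [Pi.mul_apply]
    rw [integral_mul_mul_mul_of_gaussian hc hi, integral_mul_of_gaussian hc hi,
      integral_mul_of_gaussian hc hi]
    congr 2
    by_cases h1 : p.1 = p.2 <;> by_cases h2 : q.1 = q.2 <;> simp [h1, h2]
    ring
  simp_rw [← Fintype.sum_prod_type' (fun j k => A j k ^ 2),
    ← Fintype.sum_prod_type' (fun j k => A j k * (c j _ * c k _))]
  rw [← covariance_self (by fun_prop), covariance_fun_sum_fun_sum hZ hZ]
  simp_rw [hcov]
  rw [Finset.mul_sum]
  refine Finset.sum_congr rfl fun p _ => ?_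
  simp only [mul_add, Finset.sum_add_distrib]
  rw [Finset.sum_eq_single p, Finset.sum_eq_single p.swap]
  · simp [hA p.2 p.1]
    ring
  · intro q _ hq
    rw [if_neg]
    · simp
    · rintro ⟨h1, h2⟩
      exact hq (Prod.ext h2.symm h1.symm)
  · simp
  · intro q _ hq
    rw [if_neg]
    · simp
    · rintro ⟨h1, h2⟩
      exact hq (Prod.ext h1.symm h2.symm)
  · simp

end Gaussian

/-! ### The variance of the mass of a cap -/

section CapVariance

variable {m : ℕ} {φ : Fin (2 * m + 1) → S2 → ℝ}

/-- The integral over `B_r(z) × B_r(z)` of `P_m (x · x')²`. -/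
noncomputable def capEnergy (m : ℕ) (r : ℝ) (z : S2) : ℝ :=
  ∫ x in geoBall z r, ∫ x' in geoBall z r,
    (legendre m).eval (inner ℝ (x : EuclideanSpace ℝ (Fin 3)) (x' : EuclideanSpace ℝ (Fin 3))) ^ 2
    ∂area ∂area

theorem capMean_eq {Ω : Type*} (hφ : IsHarmonicONB m φ) (c : Fin (2 * m + 1) → Ω → ℝ) (r : ℝ)
    (z : S2) : capMean φ c r z = fun ω => ∑ j, ∑ k, ((area.real (geoBall z r))⁻¹
      * ∫ x in geoBall z r, φ j x * φ k x ∂area) * (c j ω * c k ω) := by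
  have hc := hφ.continuous
  funext ω
  have e : ∀ x, randomHarmonic φ c ω x ^ 2
      = ∑ j, ∑ k, c j ω * c k ω * (φ j x * φ k x) := by
    intro x
    rw [randomHarmonic, sq, Finset.sum_mul_sum]
    exact Finset.sum_congr rfl fun j _ => Finset.sum_congr rfl fun k _ => by ring
  simp only [capMean, e]
  rw [integral_finsetSum _ fun j _ => (integrable_of_continuous (by fun_prop)).integrableOn,
    Finset.mul_sum]
  refine Finset.sum_congr rfl fun j _ => ?_
  rw [integral_finsetSum _ fun k _ => (integrable_of_continuous (by fun_prop)).integrableOn,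
    Finset.mul_sum]
  refine Finset.sum_congr rfl fun k _ => ?_
  rw [integral_const_mul]
  ring

theorem sum_sq_integral_eq (hφ : IsHarmonicONB m φ) (r : ℝ) (z : S2) :
    ∑ j, ∑ k, (∫ x in geoBall z r, φ j x * φ k x ∂area) ^ 2
      = ((2 * m + 1) / area.real Set.univ) ^ 2 * capEnergy m r z := by
  have hc := hφ.continuous
  have e : ∀ x x' : S2, ((2 * m + 1) / area.real Set.univ) ^ 2 * (legendre m).eval
      (inner ℝ (x : EuclideanSpace ℝ (Fin 3)) (x' : EuclideanSpace ℝ (Fin 3))) ^ 2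
      = ∑ j, ∑ k, φ j x * φ k x * (φ j x' * φ k x') := by
    intro x x'
    rw [← mul_pow, ← hφ.sphereKernel_eq, sphereKernel, sq, Finset.sum_mul_sum]
    exact Finset.sum_congr rfl fun j _ => Finset.sum_congr rfl fun k _ => by ring
  rw [capEnergy, ← integral_const_mul]
  simp only [← integral_const_mul, e]
  have e2 : ∀ x : S2, ∫ x' in geoBall z r, ∑ j, ∑ k, φ j x * φ k x * (φ j x' * φ k x') ∂area
      = ∑ j, ∑ k, φ j x * φ k x * ∫ x' in geoBall z r, φ j x' * φ k x' ∂area := by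
    intro x
    rw [integral_finsetSum _ fun j _ => (integrable_of_continuous (by fun_prop)).integrableOn]
    refine Finset.sum_congr rfl fun j _ => ?_
    rw [integral_finsetSum _ fun k _ => (integrable_of_continuous (by fun_prop)).integrableOn]
    exact Finset.sum_congr rfl fun k _ => integral_const_mul _ _
  simp only [e2]
  rw [integral_finsetSum _ fun j _ => (integrable_of_continuous (by fun_prop)).integrableOn]
  refine Finset.sum_congr rfl fun j _ => ?_
  rw [integral_finsetSum _ fun k _ => (integrable_of_continuous (by fun_prop)).integrableOn]
  refine Finset.sum_congr rfl fun k _ => ?_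
  rw [integral_mul_const, sq]

theorem memLp_capMean {Ω : Type*} [MeasurableSpace Ω] {P : Measure Ω} (hφ : IsHarmonicONB m φ)
    {c : Fin (2 * m + 1) → Ω → ℝ} (hc : IsGaussianCoeff P m c) (r : ℝ) (z : S2) :
    MemLp (capMean φ c r z) 2 P := by
  rw [capMean_eq hφ]
  exact memLp_quadratic_of_gaussian hc.hasLaw _

theorem variance_capMean {Ω : Type*} [MeasurableSpace Ω] {P : Measure Ω}
    (hφ : IsHarmonicONB m φ) {c : Fin (2 * m + 1) → Ω → ℝ} (hc : IsGaussianCoeff P m c) (r : ℝ)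
    (z : S2) : variance (capMean φ c r z) P
      = 2 / area.real Set.univ ^ 2 * (capEnergy m r z / area.real (geoBall z r) ^ 2) := by
  rw [capMean_eq hφ, variance_quadratic_of_gaussian hc.hasLaw hc.indep _
    fun j k => by simp only [mul_comm]]
  simp only [mul_pow, ← Finset.mul_sum, sum_sq_integral_eq hφ]
  have := area_real_univ_pos.ne'
  have h2 : (2 * (m : ℝ) + 1) ≠ 0 := by positivity
  push_cast
  field_simp

theorem continuous_legendre_sq (m : ℕ) : Continuous fun t : ℝ => (legendre m).eval t ^ 2 :=
  (legendre m).continuous.pow 2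

theorem continuous_legendre_inner_sq (m : ℕ) : Continuous fun p : S2 × S2 =>
    (legendre m).eval (inner ℝ (p.1 : EuclideanSpace ℝ (Fin 3))
      (p.2 : EuclideanSpace ℝ (Fin 3))) ^ 2 :=
  (continuous_legendre_sq m).comp (by fun_prop)

theorem integrable_legendre_inner_sq (m : ℕ) (x : S2) : Integrable (fun x' : S2 =>
    (legendre m).eval (inner ℝ (x : EuclideanSpace ℝ (Fin 3))
      (x' : EuclideanSpace ℝ (Fin 3))) ^ 2) area :=
  integrable_of_continuous ((continuous_legendre_sq m).comp (by fun_prop))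

/-- The `L²` norm of a Legendre polynomial, from the reproducing property of the kernel. -/
theorem integral_legendre_inner_sq (hφ : IsHarmonicONB m φ) (x : S2) :
    ∫ x' : S2, (legendre m).eval (inner ℝ (x : EuclideanSpace ℝ (Fin 3))
      (x' : EuclideanSpace ℝ (Fin 3))) ^ 2 ∂area = area.real Set.univ / (2 * m + 1) := by
  have hc := hφ.continuous
  have ha := area_real_univ_pos.ne'
  have h2 : (2 * (m : ℝ) + 1) ≠ 0 := by positivity
  have h : ∫ x', sphereKernel φ x x' ^ 2 ∂area = sphereKernel φ x x := by
    simp only [sphereKernel, sq, Finset.sum_mul_sum]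
    rw [integral_finsetSum _ fun j _ => integrable_of_continuous (by fun_prop)]
    refine Finset.sum_congr rfl fun j _ => ?_
    rw [integral_finsetSum _ fun k _ => integrable_of_continuous (by fun_prop)]
    have e : ∀ k, ∫ x', φ j x * φ j x' * (φ k x * φ k x') ∂area
        = φ j x * φ k x * if j = k then 1 else 0 := by
      intro k
      rw [← hφ.orthonormal j k, ← integral_const_mul]
      exact integral_congr_ae (Filter.Eventually.of_forall fun x => by ring)
    simp [e]
  simp only [hφ.sphereKernel_eq, mul_pow, integral_const_mul] at h
  simp only [real_inner_self_eq_norm_sq, norm_eq_of_mem_sphere, one_pow, legendre_eval_one] at h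
  field_simp at h ⊢
  linarith

/-- The mass of `P_m (x · x')²` over a cap centred at `x`, as an integral over the polar angle. -/
theorem setIntegral_legendre_inner_sq (m : ℕ) (x : S2) {R : ℝ} (h0 : 0 ≤ R) (hR : R ≤ Real.pi) :
    ∫ x' in geoBall x R, (legendre m).eval (inner ℝ (x : EuclideanSpace ℝ (Fin 3))
      (x' : EuclideanSpace ℝ (Fin 3))) ^ 2 ∂area
      = 2 * Real.pi * ∫ θ in 0..R, Real.sin θ * (legendre m).eval (Real.cos θ) ^ 2 := by
  rw [← setIntegral_geoBall x h0 hR (F := fun t => (legendre m).eval t ^ 2)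
    (continuous_legendre_sq m) fun t => sq_nonneg _]
  simp only [real_inner_comm]

theorem le_sqrt_mul_succ (m : ℕ) : (m : ℝ) ≤ √((m : ℝ) * (m + 1)) :=
  Real.le_sqrt_of_sq_le (by nlinarith [(Nat.cast_nonneg m : (0 : ℝ) ≤ m)])

theorem sqrt_mul_succ_le (hm : 1 ≤ m) : √((m : ℝ) * (m + 1)) ≤ 2 * m := by
  have hm' : (1 : ℝ) ≤ m := by exact_mod_cast hm
  exact Real.sqrt_le_iff.2 ⟨by positivity, by nlinarith⟩

theorem integrableOn_capEnergy (m : ℕ) (r : ℝ) (z : S2) (s : Set S2) :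
    IntegrableOn (fun x : S2 => ∫ x' in geoBall z r, (legendre m).eval
      (inner ℝ (x : EuclideanSpace ℝ (Fin 3)) (x' : EuclideanSpace ℝ (Fin 3))) ^ 2 ∂area)
      s area := by
  have h : Integrable (fun p : S2 × S2 => (legendre m).eval (inner ℝ
      (p.1 : EuclideanSpace ℝ (Fin 3)) (p.2 : EuclideanSpace ℝ (Fin 3))) ^ 2)
      ((area.restrict s).prod (area.restrict (geoBall z r))) :=
    (continuous_legendre_inner_sq m).integrable_of_hasCompactSupport
      (HasCompactSupport.of_compactSpace _)
  exact h.integral_prod_left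

/-- A small cap lies in the cap of twice the radius about each of its points; for a large one the
`L²` norm on the whole sphere suffices. -/
theorem capEnergy_le (hφ : IsHarmonicONB m φ) (hm : 1 ≤ m) {r : ℝ} (h0 : 0 < r)
    (hr : r ≤ Real.pi) (z : S2) : capEnergy m r z / area.real (geoBall z r) ^ 2
      ≤ (16 * Real.pi + 2 * area.real Set.univ) / (r * m) := by
  have hm' : (1 : ℝ) ≤ m := by exact_mod_cast hm
  have hm0 : (0 : ℝ) < m := by linarith
  have ha := area_real_univ_pos
  have hpi := Real.pi_pos
  have hμ := le_sqrt_mul_succ m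
  have hvol := le_area_real_geoBall z h0.le hr
  have hvol0 : 0 < area.real (geoBall z r) := lt_of_lt_of_le (by positivity) hvol
  have key : ∀ x ∈ geoBall z r, ∫ x' in geoBall z r, (legendre m).eval (inner ℝ
      (x : EuclideanSpace ℝ (Fin 3)) (x' : EuclideanSpace ℝ (Fin 3))) ^ 2 ∂area
      ≤ (16 * Real.pi + 2 * area.real Set.univ) * r / m := by
    intro x hx
    rcases le_total r (Real.pi / 4) with hr4 | hr4
    · have h1 := setIntegral_mono_set (integrable_legendre_inner_sq m x).integrableOn
        (Filter.Eventually.of_forall fun x' => sq_nonneg _)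
        (geoBall_subset_geoBall (mem_geoBall_comm.1 hx) (two_mul r).ge).eventuallyLE
      refine h1.trans ?_
      rw [setIntegral_legendre_inner_sq m x (by linarith) (by linarith)]
      have h2 := (isPolarLegendre_legendre hm).integral_le (R := 2 * r)
        ⟨by linarith, by linarith⟩
      calc _ ≤ 2 * Real.pi * (4 / √((m : ℝ) * (m + 1)) * (2 * r)) := by gcongr
        _ ≤ 2 * Real.pi * (4 / m * (2 * r)) := by gcongr
        _ = 16 * Real.pi * r / m := by ring
        _ ≤ _ := by gcongr; linarith
    · have h1 := setIntegral_le_integral (s := geoBall z r) (integrable_legendre_inner_sq m x)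
        (Filter.Eventually.of_forall fun x' => sq_nonneg _)
      refine h1.trans ?_
      rw [integral_legendre_inner_sq hφ]
      -- `r` is bounded below, so the missing factor `r` is harmless
      -- `r` is bounded below, so the missing factor `r` is harmless
      have hr2 : 1 ≤ 2 * r := by linarith [Real.pi_gt_three]
      calc area.real Set.univ / (2 * m + 1) ≤ area.real Set.univ / m := by gcongr; linarith
        _ ≤ area.real Set.univ * (2 * r) / m := by
          gcongr
          exact le_mul_of_one_le_right ha.le hr2
        _ = 2 * area.real Set.univ * r / m := by ring
        _ ≤ _ := by gcongr; linarith
  have hI : capEnergy m r z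
      ≤ (16 * Real.pi + 2 * area.real Set.univ) * r / m * area.real (geoBall z r) := by
    refine (setIntegral_mono_on (integrableOn_capEnergy m r z _) (integrable_const _)
      (measurableSet_geoBall z r) key).trans_eq ?_
    rw [setIntegral_const, smul_eq_mul, mul_comm]
  calc capEnergy m r z / area.real (geoBall z r) ^ 2
      ≤ ((16 * Real.pi + 2 * area.real Set.univ) * r / m * area.real (geoBall z r))
        / area.real (geoBall z r) ^ 2 := by gcongr
    _ = (16 * Real.pi + 2 * area.real Set.univ) * r / m / area.real (geoBall z r) := by
      field_simp
    _ ≤ (16 * Real.pi + 2 * area.real Set.univ) * r / m / r ^ 2 := by gcongr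
    _ = _ := by field_simp

/-- The cap contains the cap of half its radius about each point at distance less than half the
radius from the centre. -/
theorem le_capEnergy (hm : 1 ≤ m) {r : ℝ} (h0 : 0 < r) (hr : r ≤ Real.pi) (hK : 5696 ≤ r * m)
    (z : S2) : 1 / (3840 * Real.pi) / (r * m)
      ≤ capEnergy m r z / area.real (geoBall z r) ^ 2 := by
  have hm' : (1 : ℝ) ≤ m := by exact_mod_cast hm
  have hm0 : (0 : ℝ) < m := by linarith
  have hpi := Real.pi_pos
  have hμ := le_sqrt_mul_succ m
  have hμ' := sqrt_mul_succ_le hm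
  have hvol := le_area_real_geoBall z h0.le hr
  have hvol' := area_real_geoBall_le z h0.le hr
  have hvol0 : 0 < area.real (geoBall z r) := lt_of_lt_of_le (by positivity) hvol
  have hhalf := le_area_real_geoBall z (R := r / 2) (by linarith) (by linarith)
  have key : ∀ x ∈ geoBall z (r / 2), Real.pi * r / (960 * m) ≤
      ∫ x' in geoBall z r, (legendre m).eval (inner ℝ
      (x : EuclideanSpace ℝ (Fin 3)) (x' : EuclideanSpace ℝ (Fin 3))) ^ 2 ∂area := by
    intro x hx
    have h1 := setIntegral_mono_set (integrable_legendre_inner_sq m x).integrableOn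
      (Filter.Eventually.of_forall fun x' => sq_nonneg _)
      (geoBall_subset_geoBall hx (add_halves r).le).eventuallyLE
    refine le_trans ?_ h1
    rw [setIntegral_legendre_inner_sq m x (by linarith) (by linarith)]
    -- `r m ≥ 5696` gives `μ (r / 2) ≥ 2848` for `μ = √(m (m + 1)) ≥ m`
    -- `r m ≥ 5696` gives `μ (r / 2) ≥ 2848` for `μ = √(m (m + 1)) ≥ m`
    have h2 := (isPolarLegendre_legendre hm).le_integral (R := r / 2) (by linarith) (by nlinarith)
    have hμ0 : 0 < √((m : ℝ) * (m + 1)) := by linarith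
    calc Real.pi * r / (960 * m) = 2 * Real.pi * (r / 2 / (480 * (2 * m))) := by
          field_simp
          norm_num
      _ ≤ 2 * Real.pi * (r / 2 / (480 * √((m : ℝ) * (m + 1)))) := by gcongr
      _ ≤ _ := by gcongr
  have hsub : geoBall z (r / 2) ⊆ geoBall z r := fun x hx =>
    lt_trans (b := r / 2) hx (by linarith)
  have hI : (r / 2) ^ 2 * (Real.pi * r / (960 * m)) ≤ capEnergy m r z := by
    have h1 := setIntegral_mono_on (integrable_const _) (integrableOn_capEnergy m r z _)
      (measurableSet_geoBall z (r / 2)) key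
    rw [setIntegral_const, smul_eq_mul] at h1
    refine le_trans (by gcongr) (h1.trans ?_)
    exact setIntegral_mono_set (integrableOn_capEnergy m r z _)
      (Filter.Eventually.of_forall fun x => integral_nonneg fun x' => sq_nonneg _)
      hsub.eventuallyLE
  calc 1 / (3840 * Real.pi) / (r * m)
      = (r / 2) ^ 2 * (Real.pi * r / (960 * m)) / (Real.pi * r ^ 2) ^ 2 := by
        field_simp
        norm_num
    _ ≤ (r / 2) ^ 2 * (Real.pi * r / (960 * m)) / area.real (geoBall z r) ^ 2 := by gcongr
    _ ≤ _ := by gcongr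

end CapVariance

theorem lemma4 :
    (∀ (m : ℕ) (r : ℝ) (_ : 0 < r) (z : S2)
        (φ : Fin (2 * m + 1) → S2 → ℝ) (_ : IsHarmonicONB m φ)
        (Ω : Type*) [MeasurableSpace Ω] (P : Measure Ω) [IsProbabilityMeasure P]
        (c : Fin (2 * m + 1) → Ω → ℝ) (_ : IsGaussianCoeff P m c),
        MemLp (capMean φ c r z) 2 P ∧
        variance (capMean φ c r z) P =
          2 / area.real Set.univ ^ 2 *
            ((∫ x in geoBall z r, ∫ x' in geoBall z r,
                (legendre m).eval
                  (inner ℝ (x : EuclideanSpace ℝ (Fin 3)) (x' : EuclideanSpace ℝ (Fin 3))) ^ 2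
                ∂area ∂area) / area.real (geoBall z r) ^ 2)) ∧
    (∃ C₁ C₂ K : ℝ, 0 < C₁ ∧ 0 < C₂ ∧ 0 < K ∧
      ∀ (m : ℕ) (_ : 1 ≤ m) (r : ℝ) (_ : 0 < r) (_ : r ≤ Real.pi) (z : S2)
        (φ : Fin (2 * m + 1) → S2 → ℝ) (_ : IsHarmonicONB m φ)
        (Ω : Type*) [MeasurableSpace Ω] (P : Measure Ω) [IsProbabilityMeasure P]
        (c : Fin (2 * m + 1) → Ω → ℝ) (_ : IsGaussianCoeff P m c),
        variance (capMean φ c r z) P ≤ C₂ / (r * m) ∧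
        (K ≤ r * m → C₁ / (r * m) ≤ variance (capMean φ c r z) P)) := by
  have ha := area_real_univ_pos
  have hpi := Real.pi_pos
  refine ⟨fun m r _ z φ hφ Ω _ P _ c hc =>
      ⟨memLp_capMean hφ hc r z, variance_capMean hφ hc r z⟩,
    2 / area.real Set.univ ^ 2 * (1 / (3840 * Real.pi)),
    2 / area.real Set.univ ^ 2 * (16 * Real.pi + 2 * area.real Set.univ), 5696,
    by positivity, by positivity, by norm_num, fun m hm r h0 hr z φ hφ Ω _ P _ c hc => ?_⟩
  rw [variance_capMean hφ hc, mul_div_assoc, mul_div_assoc]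
  refine ⟨?_, fun hK => ?_⟩
  · exact mul_le_mul_of_nonneg_left (capEnergy_le hφ hm h0 hr z) (by positivity)
  · exact mul_le_mul_of_nonneg_left (le_capEnergy hm h0 hr hK z) (by positivity)
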